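/- Let $\mathbb H$ be the real quaternions and let $A=(a_{ij})$ be an $n\times n$ matrix over $\mathbb H$. Its Moore determinant is $$M\det(A)=\sum_{\sigma\in S_n}\operatorname{sgn}(\sigma)\,a_{n_{11}n_{12}}\cdots a_{n_{1l_1}n_{11}}\,a_{n_{21}n_{22}}\cdots a_{n_{2l_2}n_{21}}\cdots a_{n_{r1}n_{r2}}\cdots a_{n_{rl_r}n_{r1}},$$ where $\sigma=(n_{11}\dots n_{1l_1})(n_{21}\dots n_{2l_2})\cdots(n_{r1}\dots n_{rl_r})$ is written as a product of disjoint cycles (fixed points included), each cycle starting with its smallest element, and $n_{11}>n_{21}>\dots>n_{r1}$. A right eigenvalue of $A$ is a $\mu\in\mathbb H$ with $Av=v\mu$ for some nonzero $v\in\mathbb H^n$; if $A$ is hermitian, its right eigenvalues are real, and $A$ is called positive semidefinite, written $A\succeq0$, if they are all nonnegative. Let $\mathbf H=(H_1,\dots,H_n)$ be a doubly stochastic $n$-tuple of quaternionic hermitian $n\times n$ matrices, that is, $$H_i\succeq 0,\quad \operatorname{tr}(H_i)=1\quad(1\le i\le n),\qquad \sum_{i=1}^n H_i=I.$$ Then $M\det\left(\sum_{i=1}^n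 x_iH_i\right)$ is real for all $(x_1,\dots,x_n)\in\mathbb R^n$, and at every point of $\mathbb R^n$ $$\frac{\partial^n}{\partial x_1\cdots\partial x_n}\,M\det\Big(\sum_{i=1}^n x_iH_i\Big)\ \ge\ \frac{n!}{n^n}.$$ -/

import Mathlib

open scoped Quaternion Nat

noncomputable section

/-- The product `A i₁ i₂ * A i₂ i₃ * ⋯ * A iₗ i₁` along the cycle `(i₁ i₂ … iₗ)` of `σ` that
starts at `i₁ = a`; for a fixed point `a` of `σ` this is `A a a`. -/
def cycleProduct {n : ℕ} (A : Matrix (Fin n) (Fin n) ℍ[ℝ]) (σ : Equiv.Perm (Fin n))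
    (a : Fin n) : ℍ[ℝ] :=
  ((List.range (Function.minimalPeriod σ a)).map
    fun k => A ((σ ^ k) a) ((σ ^ (k + 1)) a)).prod

/-- The smallest elements of the cycles of `σ` (fixed points count as cycles of length one),
in decreasing order. -/
def cycleLeaders {n : ℕ} (σ : Equiv.Perm (Fin n)) : List (Fin n) :=
  (List.finRange n).reverse.filter fun a => ∀ b, σ.SameCycle a b → a ≤ b

/-- The Moore determinant. Every permutation is written as a product of disjoint cycles, fixed
points included; every cycle starts with its smallest element, the cycles are sorted so that
their first elements decrease, and the entries are multiplied in this order. -/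
def mooreDet {n : ℕ} (A : Matrix (Fin n) (Fin n) ℍ[ℝ]) : ℍ[ℝ] :=
  ∑ σ : Equiv.Perm (Fin n),
    (Equiv.Perm.sign σ : ℤ) • ((cycleLeaders σ).map (cycleProduct A σ)).prod

/-- `μ` is a right eigenvalue of `A`: `A v = v μ` for some nonzero column vector `v`. -/
def IsRightEigenvalue {n : ℕ} (A : Matrix (Fin n) (Fin n) ℍ[ℝ]) (μ : ℍ[ℝ]) : Prop :=
  ∃ v : Fin n → ℍ[ℝ], v ≠ 0 ∧ A.mulVec v = fun i => v i * μ

/-- Quaternionic positive semidefinite: hermitian, with nonnegative right eigenvalues. (The right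
eigenvalues of a hermitian matrix are real, so it is enough to speak of the real ones.) -/
def IsQuaternionicPSD {n : ℕ} (A : Matrix (Fin n) (Fin n) ℍ[ℝ]) : Prop :=
  A.IsHermitian ∧ ∀ μ : ℝ, IsRightEigenvalue A (μ : ℍ[ℝ]) → 0 ≤ μ

/-- A doubly stochastic `n`-tuple of quaternionic hermitian `n × n` matrices. -/
structure IsDoublyStochasticTuple {n : ℕ} (H : Fin n → Matrix (Fin n) (Fin n) ℍ[ℝ]) : Prop where
  psd : ∀ i, IsQuaternionicPSD (H i)
  trace_eq_one : ∀ i, (H i).trace = 1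
  sum_eq_one : ∑ i, H i = 1

/-- `Q_H(x₁, …, xₙ) = Mdet(∑ xᵢ Hᵢ)` as a real-valued function of `n` real variables. -/
def mooreForm {n : ℕ} (H : Fin n → Matrix (Fin n) (Fin n) ℍ[ℝ]) (x : Fin n → ℝ) : ℝ :=
  (mooreDet (∑ i, x i • H i)).re

/-- The mixed derivative `∂ⁿ f / ∂x₁ ⋯ ∂xₙ` at the point `x`. -/
def mixedDerivative {n : ℕ} (f : (Fin n → ℝ) → ℝ) (x : Fin n → ℝ) : ℝ :=
  iteratedFDeriv ℝ n f x fun i => Pi.single i 1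

end

/-!
Write `p(x)` for the Moore determinant of the pencil `∑ xᵢ Hᵢ`. The bound is Gurvits' capacity
inequality for `p`: a form of degree `n` in `n` variables without zeros in the product of the open
right half-planes, which dominates `x₁ ⋯ xₙ` on the positive orthant, has coefficient at least
`n! / nⁿ` at `x₁ ⋯ xₙ` (`IsStable.capacity_le_coeff`). The mixed derivative of such a form is
constant and equal to that coefficient (`mixedDerivative_eval`).

To verify the hypotheses, `p` is compared with the determinant of the pencil of real `4n × 4n`
matrices `∑ xᵢ R(Hᵢ)`, where `R` is the real representation of quaternionic matrices: one has
`p⁴ = det (∑ xᵢ R(Hᵢ))` (`exists_polynomial_mooreDet`). The matrices `R(Hᵢ)` are positive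
semidefinite of trace `4` with sum `1`, so the determinant has no zeros when all `Re zᵢ > 0`
(`det_sum_smul_ne_zero`), and it is at least `(x₁ ⋯ xₙ)⁴` on the positive orthant by the weighted
inequality of arithmetic and geometric means in an eigenbasis (`prod_pow_le_det_sum_smul`).

The identity for `p⁴` is an identity of polynomials, so it suffices to prove it on the positive
orthant, where the pencil is positive definite. For a single matrix `A`, splitting off the first
step of the cycle through a chosen index expresses the Moore determinants of the principal
submatrices of `A`, together with similar sums in which one cycle is left open, by those of smaller
size (`mooreOn_eq_pathSum`, `pathSum_eq`). When `A` is positive definite, the same recursion is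
satisfied by the positive fourth roots of the real determinants of the principal submatrices and by
the rows of their inverses, scaled by these roots; hence the two families agree
(`mooreOn_of_posDef`). In particular the Moore determinant is real there, although the single
cycle products are not.

The capacity inequality is proved by passing to the linear coefficient in one variable at a time.
With the other variables real and positive, the form has only negative roots in that variable, and
a univariate estimate bounds the loss by the factor `(k / (k + 1)) ^ k`
(`Polynomial.le_coeff_one_of_roots_neg`); these factors multiply to `n! / nⁿ`. A small perturbation
of the variables makes the form zero-free up to the boundary, which is what survives the
passage to the linear coefficient (`IsStrictlyStable.coeff_one`).
-/

/-! ### Expanding the Moore determinant along a cycle -/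

section Recursion

open Equiv Equiv.Perm Function

variable {n : ℕ}

/-- The permutations that fix every point outside `S`. -/
def permsOn (S : Finset (Fin n)) : Finset (Perm (Fin n)) :=
  Finset.univ.filter fun σ => ∀ x, x ∉ S → σ x = x

/-- The Moore determinant of the principal submatrix of `A` with index set `S`. -/
noncomputable def mooreOn (A : Matrix (Fin n) (Fin n) ℍ[ℝ]) (S : Finset (Fin n)) : ℍ[ℝ] :=
  ∑ σ ∈ permsOn S, (Equiv.Perm.sign σ : ℤ) •
    (((cycleLeaders σ).filter fun a => a ∈ S).map (cycleProduct A σ)).prod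

/-- The word read off along the cycle of `σ` through `i`, from `i` on, in which the last factor
`A (σ⁻¹ i) i` is replaced by `c (σ⁻¹ i)`. -/
noncomputable def cyclePath (A : Matrix (Fin n) (Fin n) ℍ[ℝ]) (σ : Perm (Fin n)) (i : Fin n)
    (c : Fin n → ℍ[ℝ]) : ℍ[ℝ] :=
  ((List.range (minimalPeriod σ i - 1)).map fun k => A ((σ ^ k) i) ((σ ^ (k + 1)) i)).prod *
    c (σ⁻¹ i)

/-- The variant of `mooreOn` in which the cycle through the chosen index `i` is read last and from
`i` on, is preceded by a factor `y`, and closes up with an entry of the column `c`. -/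
noncomputable def pathSum (A : Matrix (Fin n) (Fin n) ℍ[ℝ]) (S : Finset (Fin n)) (i : Fin n)
    (y : ℍ[ℝ]) (c : Fin n → ℍ[ℝ]) : ℍ[ℝ] :=
  ∑ σ ∈ permsOn S, (Equiv.Perm.sign σ : ℤ) •
    ((((cycleLeaders σ).filter fun a => a ∈ S ∧ ¬ σ.SameCycle i a).map (cycleProduct A σ)).prod *
      y * cyclePath A σ i c)

theorem mem_permsOn {S : Finset (Fin n)} {σ : Perm (Fin n)} :
    σ ∈ permsOn S ↔ ∀ x, x ∉ S → σ x = x := by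
  simp [permsOn]

theorem mem_cycleLeaders {σ : Perm (Fin n)} {a : Fin n} :
    a ∈ cycleLeaders σ ↔ ∀ b, σ.SameCycle a b → a ≤ b := by
  simp [cycleLeaders]

theorem pairwise_cycleLeaders (σ : Perm (Fin n)) : (cycleLeaders σ).Pairwise (· > ·) := by
  refine List.Pairwise.filter _ ?_
  rw [List.pairwise_reverse]
  exact List.pairwise_lt_finRange n

theorem List.eq_of_pairwise_gt {l₁ l₂ : List (Fin n)} (h₁ : l₁.Pairwise (· > ·))
    (h₂ : l₂.Pairwise (· > ·)) (h : ∀ a, a ∈ l₁ ↔ a ∈ l₂) : l₁ = l₂ := by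
  have n₁ : l₁.Nodup := h₁.imp fun hab => ne_of_gt hab
  have n₂ : l₂.Nodup := h₂.imp fun hab => ne_of_gt hab
  exact ((List.perm_ext_iff_of_nodup n₁ n₂).2 h).eq_of_pairwise'
    (h₁.imp fun hab => le_of_lt hab) (h₂.imp fun hab => le_of_lt hab)

theorem mooreOn_univ (A : Matrix (Fin n) (Fin n) ℍ[ℝ]) : mooreOn A Finset.univ = mooreDet A := by
  simp [mooreOn, mooreDet, permsOn]

theorem mooreOn_empty (A : Matrix (Fin n) (Fin n) ℍ[ℝ]) : mooreOn A ∅ = 1 := by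
  have h : (permsOn ∅ : Finset (Perm (Fin n))) = {1} := by
    ext σ
    simp [mem_permsOn, Equiv.ext_iff]
  simp [mooreOn, h]

theorem minimalPeriod_perm_pos (σ : Perm (Fin n)) (i : Fin n) : 0 < minimalPeriod σ i := by
  refine minimalPeriod_pos_of_mem_periodicPts ⟨orderOf σ, orderOf_pos σ, ?_⟩
  rw [IsPeriodicPt, IsFixedPt, Equiv.Perm.iterate_eq_pow, pow_orderOf_eq_one]
  rfl

theorem pow_minimalPeriod_apply (σ : Perm (Fin n)) (i : Fin n) :
    (σ ^ minimalPeriod σ i) i = i := by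
  rw [← Equiv.Perm.iterate_eq_pow]
  exact iterate_minimalPeriod

theorem pow_minimalPeriod_sub_one (σ : Perm (Fin n)) (i : Fin n) :
    (σ ^ (minimalPeriod σ i - 1)) i = σ⁻¹ i := by
  rw [Equiv.Perm.eq_inv_iff_eq, ← Perm.mul_apply, ← pow_succ',
    Nat.sub_add_cancel (minimalPeriod_perm_pos σ i), pow_minimalPeriod_apply]

theorem cycleProduct_eq_cyclePath (A : Matrix (Fin n) (Fin n) ℍ[ℝ]) (σ : Perm (Fin n))
    (i : Fin n) : cycleProduct A σ i = cyclePath A σ i fun k => A k i := by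
  have h := Nat.sub_add_cancel (minimalPeriod_perm_pos σ i)
  rw [cycleProduct, cyclePath, ← h, List.range_succ, List.map_append, List.prod_append]
  simp only [List.map_cons, List.map_nil, List.prod_cons, List.prod_nil, mul_one,
    Nat.add_sub_cancel]
  rw [pow_minimalPeriod_sub_one, h, pow_minimalPeriod_apply]

theorem sameCycle_mem {S : Finset (Fin n)} {σ : Perm (Fin n)} (hσ : σ ∈ permsOn S) {a b : Fin n}
    (ha : a ∈ S) (h : σ.SameCycle a b) : b ∈ S := by
  by_contra hb
  have : b = a := h.symm.eq_of_left (mem_permsOn.1 hσ b hb)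
  exact hb (this ▸ ha)

/-- The cycle of the smallest index comes last in the Moore determinant. -/
theorem mooreOn_eq_pathSum (A : Matrix (Fin n) (Fin n) ℍ[ℝ]) {S : Finset (Fin n)} {m : Fin n}
    (hm : m ∈ S) (hmin : ∀ a ∈ S, m ≤ a) :
    mooreOn A S = pathSum A S m 1 fun k => A k m := by
  refine Finset.sum_congr rfl fun σ hσ => ?_
  have hl : ((cycleLeaders σ).filter fun a => a ∈ S) =
      ((cycleLeaders σ).filter fun a => a ∈ S ∧ ¬ σ.SameCycle m a) ++ [m] := by
    refine List.eq_of_pairwise_gt ((pairwise_cycleLeaders σ).filter _) ?_ fun a => ?_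
    · refine List.pairwise_append.2 ⟨(pairwise_cycleLeaders σ).filter _,
        List.pairwise_singleton _ _, fun a ha b hb => ?_⟩
      simp only [List.mem_filter, decide_eq_true_eq] at ha
      rw [List.mem_singleton.1 hb]
      refine lt_of_le_of_ne (hmin a ha.2.1) fun h => ha.2.2 (h ▸ SameCycle.refl σ a)
    · simp only [List.mem_filter, decide_eq_true_eq, List.mem_append, List.mem_singleton,
        mem_cycleLeaders]
      constructor
      · rintro ⟨h1, h2⟩
        by_cases h : σ.SameCycle m a
        · exact Or.inr (le_antisymm (h1 m h.symm) (hmin a h2))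
        · exact Or.inl ⟨h1, h2, h⟩
      · rintro (⟨h1, h2, -⟩ | rfl)
        · exact ⟨h1, h2⟩
        · exact ⟨fun b hb => hmin b (sameCycle_mem hσ hm hb), hm⟩
  rw [hl, List.map_append, List.prod_append, mul_one]
  simp only [List.map_cons, List.map_nil, List.prod_cons, List.prod_nil, mul_one,
    cycleProduct_eq_cyclePath A σ m]

section Insert

variable {τ : Perm (Fin n)} {i j : Fin n}

/-- Multiplying `τ` by `swap i j` inserts the fixed point `i` of `τ` into the cycle of `j`,
immediately before `j`. -/
theorem pow_succ_swap_mul (hτ : τ i = i) (hij : j ≠ i) {k : ℕ} (hk : k < minimalPeriod τ j) :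
    ((swap i j * τ) ^ (k + 1)) i = (τ ^ k) j := by
  induction k with
  | zero => simp [hτ]
  | succ k ih =>
    rw [pow_succ', Perm.mul_apply, ih (by omega), Perm.mul_apply, ← Perm.mul_apply τ, ← pow_succ']
    refine swap_apply_of_ne_of_ne (fun h => hij ?_) fun h => ?_
    · have h2 : (τ ^ (k + 1)) i = i := Equiv.Perm.pow_apply_eq_self_of_apply_eq_self hτ _
      exact (τ ^ (k + 1)).injective (h.trans h2.symm)
    · refine not_isPeriodicPt_of_pos_of_lt_minimalPeriod (Nat.succ_ne_zero k) hk ?_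
      rw [IsPeriodicPt, IsFixedPt, Equiv.Perm.iterate_eq_pow, h]

theorem inv_swap_mul_apply : (swap i j * τ)⁻¹ i = τ⁻¹ j := by
  rw [Perm.inv_eq_iff_eq]
  simp

theorem minimalPeriod_swap_mul (hτ : τ i = i) (hij : j ≠ i) :
    minimalPeriod (swap i j * τ) i = minimalPeriod τ j + 1 := by
  have hpos := minimalPeriod_perm_pos τ j
  refine le_antisymm (IsPeriodicPt.minimalPeriod_le (Nat.succ_pos _) ?_) ?_
  · rw [IsPeriodicPt, IsFixedPt, Equiv.Perm.iterate_eq_pow, pow_succ', Perm.mul_apply]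
    obtain ⟨L, hL⟩ := Nat.exists_eq_succ_of_ne_zero hpos.ne'
    rw [hL, Nat.succ_eq_add_one, pow_succ_swap_mul hτ hij (by omega), Perm.mul_apply,
      ← Perm.mul_apply τ, ← pow_succ']
    rw [show L + 1 = minimalPeriod τ j from hL.symm, pow_minimalPeriod_apply, swap_apply_right]
  · by_contra! hlt
    have h1 := pow_minimalPeriod_apply (swap i j * τ) i
    obtain ⟨L, hL⟩ := Nat.exists_eq_succ_of_ne_zero (minimalPeriod_perm_pos (swap i j * τ) i).ne'
    rw [hL, Nat.succ_eq_add_one, pow_succ_swap_mul hτ hij (by omega)] at h1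
    have h2 : (τ ^ L) i = i := Equiv.Perm.pow_apply_eq_self_of_apply_eq_self hτ _
    exact hij ((τ ^ L).injective (h1.trans h2.symm))

theorem cyclePath_swap_mul (A : Matrix (Fin n) (Fin n) ℍ[ℝ]) (c : Fin n → ℍ[ℝ]) (hτ : τ i = i)
    (hij : j ≠ i) : cyclePath A (swap i j * τ) i c = A i j * cyclePath A τ j c := by
  have hpos := minimalPeriod_perm_pos τ j
  obtain ⟨L, hL⟩ := Nat.exists_eq_succ_of_ne_zero hpos.ne'
  rw [cyclePath, cyclePath, minimalPeriod_swap_mul hτ hij, inv_swap_mul_apply,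
    Nat.add_sub_cancel, ← mul_assoc]
  congr 1
  rw [hL, Nat.succ_eq_add_one, Nat.add_sub_cancel, List.range_succ_eq_map, List.map_cons,
    List.prod_cons, List.map_map]
  congr 1
  · simp [hτ]
  · congr 1
    refine List.map_congr_left fun k hk => ?_
    rw [List.mem_range] at hk
    simp only [Function.comp_apply, Nat.succ_eq_add_one]
    rw [pow_succ_swap_mul hτ hij (by omega), pow_succ_swap_mul hτ hij (by omega)]

theorem pow_swap_mul_of_not_sameCycle (hτ : τ i = i) {a : Fin n} (hai : a ≠ i)
    (ha : ¬ τ.SameCycle j a) (k : ℕ) : ((swap i j * τ) ^ k) a = (τ ^ k) a := by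
  induction k with
  | zero => simp
  | succ k ih =>
    rw [pow_succ', Perm.mul_apply, ih, Perm.mul_apply, ← Perm.mul_apply τ, ← pow_succ']
    refine swap_apply_of_ne_of_ne (fun h => hai ?_) fun h => ha ?_
    · have h2 : (τ ^ (k + 1)) i = i := Equiv.Perm.pow_apply_eq_self_of_apply_eq_self hτ _
      exact (τ ^ (k + 1)).injective (h.trans h2.symm)
    · exact SameCycle.symm ⟨(k + 1 : ℕ), by rw [zpow_natCast, h]⟩

theorem sameCycle_iff_exists_pow {σ : Perm (Fin n)} {a b : Fin n} :
    σ.SameCycle a b ↔ ∃ k : ℕ, (σ ^ k) a = b :=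
  ⟨fun h => h.exists_nat_pow_eq, fun ⟨k, hk⟩ => ⟨k, by rw [zpow_natCast, hk]⟩⟩

theorem sameCycle_swap_mul_iff (hτ : τ i = i) (hij : j ≠ i) {a : Fin n} :
    (swap i j * τ).SameCycle i a ↔ a = i ∨ τ.SameCycle j a := by
  constructor
  · intro h
    by_contra! hc
    obtain ⟨k, hk⟩ := sameCycle_iff_exists_pow.1 h.symm
    rw [pow_swap_mul_of_not_sameCycle hτ hc.1 hc.2] at hk
    have h2 : (τ ^ k) i = i := Equiv.Perm.pow_apply_eq_self_of_apply_eq_self hτ _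
    exact hc.1 ((τ ^ k).injective (hk.trans h2.symm))
  · rintro (rfl | h)
    · exact SameCycle.refl _ _
    · obtain ⟨k, hk⟩ := sameCycle_iff_exists_pow.1 h
      refine sameCycle_iff_exists_pow.2 ⟨k % minimalPeriod τ j + 1, ?_⟩
      rw [pow_succ_swap_mul hτ hij (Nat.mod_lt _ (minimalPeriod_perm_pos τ j)), ← hk,
        ← Equiv.Perm.iterate_eq_pow, ← Equiv.Perm.iterate_eq_pow, iterate_mod_minimalPeriod_eq]

theorem sameCycle_swap_mul_iff_of_not (hτ : τ i = i) {a b : Fin n} (hai : a ≠ i)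
    (ha : ¬ τ.SameCycle j a) : (swap i j * τ).SameCycle a b ↔ τ.SameCycle a b := by
  simp only [sameCycle_iff_exists_pow, pow_swap_mul_of_not_sameCycle hτ hai ha]

theorem cycleProduct_swap_mul (A : Matrix (Fin n) (Fin n) ℍ[ℝ]) (hτ : τ i = i) {a : Fin n}
    (hai : a ≠ i) (ha : ¬ τ.SameCycle j a) :
    cycleProduct A (swap i j * τ) a = cycleProduct A τ a := by
  have h : minimalPeriod (swap i j * τ) a = minimalPeriod τ a := by
    rw [minimalPeriod_eq_minimalPeriod_iff]
    intro k
    rw [IsPeriodicPt, IsFixedPt, IsPeriodicPt, IsFixedPt, Equiv.Perm.iterate_eq_pow,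
      Equiv.Perm.iterate_eq_pow, pow_swap_mul_of_not_sameCycle hτ hai ha]
  simp only [cycleProduct, h, pow_swap_mul_of_not_sameCycle hτ hai ha]

end Insert

/-- A permutation `σ` of `S` is recorded by `j = σ i` and by the permutation of `S.erase i` that is
left when `i` is removed from its cycle. -/
theorem sum_permsOn {M : Type*} [AddCommMonoid M] (F : Perm (Fin n) → M) {S : Finset (Fin n)}
    {i : Fin n} (hi : i ∈ S) :
    ∑ σ ∈ permsOn S, F σ = ∑ j ∈ S, ∑ τ ∈ permsOn (S.erase i), F (swap i j * τ) := by
  rw [← Finset.sum_product']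
  refine Finset.sum_nbij' (fun σ => (σ i, swap i (σ i) * σ)) (fun p => swap i p.1 * p.2)
    ?_ ?_ ?_ ?_ ?_
  · intro σ hσ
    have hσi : σ i ∈ S := sameCycle_mem hσ hi ⟨1, by simp⟩
    refine Finset.mem_product.2 ⟨hσi, mem_permsOn.2 fun x hx => ?_⟩
    rw [Perm.mul_apply]
    by_cases hxi : x = i
    · rw [hxi, swap_apply_right]
    · have hxS : x ∉ S := fun h => hx (Finset.mem_erase.2 ⟨hxi, h⟩)
      rw [mem_permsOn.1 hσ x hxS]
      exact swap_apply_of_ne_of_ne hxi fun h => hxS (h ▸ hσi)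
  · rintro ⟨j, τ⟩ h
    rw [Finset.mem_product] at h
    refine mem_permsOn.2 fun x hx => ?_
    rw [Perm.mul_apply, mem_permsOn.1 h.2 x fun h' => hx (Finset.mem_of_mem_erase h')]
    exact swap_apply_of_ne_of_ne (fun h' => hx (h' ▸ hi)) fun h' => hx (h' ▸ h.1)
  · intro σ _
    simp [← mul_assoc]
  · rintro ⟨j, τ⟩ h
    rw [Finset.mem_product] at h
    have hτ : τ i = i := mem_permsOn.1 h.2 i (Finset.notMem_erase i S)
    simp [hτ, ← mul_assoc]
  · intro σ _
    simp [← mul_assoc]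

/-- Splitting off the first step `i → j` of the cycle through `i`. -/
theorem pathSum_eq (A : Matrix (Fin n) (Fin n) ℍ[ℝ]) {S : Finset (Fin n)} {i : Fin n}
    (hi : i ∈ S) (y : ℍ[ℝ]) (c : Fin n → ℍ[ℝ]) :
    pathSum A S i y c = mooreOn A (S.erase i) * y * c i -
      ∑ j ∈ S.erase i, pathSum A (S.erase i) j (y * A i j) c := by
  rw [pathSum, sum_permsOn _ hi, ← Finset.add_sum_erase S _ hi, sub_eq_add_neg]
  congr 1
  · rw [mooreOn, Finset.sum_mul, Finset.sum_mul]
    refine Finset.sum_congr rfl fun τ hτ => ?_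
    have hfix : τ i = i := mem_permsOn.1 hτ i (Finset.notMem_erase i S)
    rw [swap_self, show (Equiv.refl (Fin n) : Perm (Fin n)) = 1 from rfl, one_mul]
    have hfil : ((cycleLeaders τ).filter fun a => a ∈ S ∧ ¬ τ.SameCycle i a) =
        (cycleLeaders τ).filter fun a => a ∈ S.erase i := by
      refine List.filter_congr fun a _ => ?_
      have : τ.SameCycle i a ↔ a = i :=
        ⟨fun h => (h.eq_of_left hfix).symm, fun h => h ▸ SameCycle.refl _ _⟩
      simp [this, and_comm]
    have hper : minimalPeriod τ i = 1 := minimalPeriod_eq_one_iff_isFixedPt.2 hfix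
    have hinv : τ⁻¹ i = i := by rw [Perm.inv_eq_iff_eq, hfix]
    rw [hfil, cyclePath, hper, hinv]
    simp [mul_assoc]
  · rw [← Finset.sum_neg_distrib]
    refine Finset.sum_congr rfl fun j hj => ?_
    rw [pathSum, ← Finset.sum_neg_distrib]
    refine Finset.sum_congr rfl fun τ hτ => ?_
    have hfix : τ i = i := mem_permsOn.1 hτ i (Finset.notMem_erase i S)
    have hji : j ≠ i := Finset.ne_of_mem_erase hj
    have hlist : ((cycleLeaders (swap i j * τ)).filter
          fun a => a ∈ S ∧ ¬ (swap i j * τ).SameCycle i a) =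
        (cycleLeaders τ).filter fun a => a ∈ S.erase i ∧ ¬ τ.SameCycle j a := by
      refine List.eq_of_pairwise_gt ((pairwise_cycleLeaders _).filter _)
        ((pairwise_cycleLeaders _).filter _) fun a => ?_
      simp only [List.mem_filter, mem_cycleLeaders, decide_eq_true_eq,
        sameCycle_swap_mul_iff hfix hji, not_or, Finset.mem_erase]
      constructor
      · rintro ⟨h1, h2, h3, h4⟩
        simp only [sameCycle_swap_mul_iff_of_not hfix h3 h4] at h1
        exact ⟨h1, ⟨h3, h2⟩, h4⟩
      · rintro ⟨h1, ⟨h3, h2⟩, h4⟩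
        simp only [sameCycle_swap_mul_iff_of_not hfix h3 h4]
        exact ⟨h1, h2, h3, h4⟩
    have hmap : ((cycleLeaders τ).filter fun a => a ∈ S.erase i ∧ ¬ τ.SameCycle j a).map
          (cycleProduct A (swap i j * τ)) =
        ((cycleLeaders τ).filter fun a => a ∈ S.erase i ∧ ¬ τ.SameCycle j a).map
          (cycleProduct A τ) := by
      refine List.map_congr_left fun a ha => ?_
      simp only [List.mem_filter, decide_eq_true_eq, Finset.mem_erase] at ha
      exact cycleProduct_swap_mul A hfix ha.2.1.1 ha.2.2
    rw [hlist, hmap, cyclePath_swap_mul A c hfix hji, Perm.sign_mul, Perm.sign_swap hji.symm]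
    simp [mul_assoc]

end Recursion

/-! ### The real representation of quaternionic matrices -/

section RealRep

open Matrix

variable {n : ℕ}

/-- Left multiplication by a quaternion, as a real matrix in the basis `1, i, j, k`. -/
noncomputable def quaternionMatrix : ℍ[ℝ] →ₐ[ℝ] Matrix (Fin 4) (Fin 4) ℝ :=
  AlgHom.ofLinearMap
    { toFun := fun q => !![q.re, -q.imI, -q.imJ, -q.imK; q.imI, q.re, -q.imK, q.imJ;
        q.imJ, q.imK, q.re, -q.imI; q.imK, -q.imJ, q.imI, q.re]
      map_add' := fun p q => by
        ext a b
        fin_cases a <;> fin_cases b <;> simp <;> ring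
      map_smul' := fun r q => by
        ext a b
        fin_cases a <;> fin_cases b <;> simp }
    (by
      ext a b
      fin_cases a <;> fin_cases b <;> simp)
    (fun p q => by
      ext a b
      fin_cases a <;> fin_cases b <;> simp [Matrix.mul_apply, Fin.sum_univ_four] <;> ring)

/-- A quaternionic `n × n` matrix as a real `4n × 4n` matrix. -/
noncomputable def realRep :
    Matrix (Fin n) (Fin n) ℍ[ℝ] →ₐ[ℝ] Matrix (Fin n × Fin 4) (Fin n × Fin 4) ℝ :=
  (compAlgEquiv (Fin n) (Fin 4) ℝ ℝ).toAlgHom.comp quaternionMatrix.mapMatrix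

theorem realRep_apply (A : Matrix (Fin n) (Fin n) ℍ[ℝ]) (p q : Fin n × Fin 4) :
    realRep A p q = quaternionMatrix (A p.1 q.1) p.2 q.2 := rfl

theorem quaternionMatrix_apply (q : ℍ[ℝ]) :
    quaternionMatrix q = !![q.re, -q.imI, -q.imJ, -q.imK; q.imI, q.re, -q.imK, q.imJ;
        q.imJ, q.imK, q.re, -q.imI; q.imK, -q.imJ, q.imI, q.re] := rfl

theorem quaternionMatrix_coe (r : ℝ) : quaternionMatrix (r : ℍ[ℝ]) = r • 1 := by
  ext a b
  fin_cases a <;> fin_cases b <;> simp [quaternionMatrix_apply]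

theorem quaternionMatrix_injective : Function.Injective quaternionMatrix := by
  intro p q h
  rw [quaternionMatrix_apply, quaternionMatrix_apply] at h
  have h0 := congrFun (congrFun h 0) 0
  have h1 := congrFun (congrFun h 1) 0
  have h2 := congrFun (congrFun h 2) 0
  have h3 := congrFun (congrFun h 3) 0
  simp at h0 h1 h2 h3
  exact QuaternionAlgebra.ext h0 h1 h2 h3

theorem realRep_injective :
    Function.Injective (realRep : Matrix (Fin n) (Fin n) ℍ[ℝ] →ₐ[ℝ] _) := by
  intro A B h
  ext1 i j
  refine quaternionMatrix_injective ?_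
  ext a b
  exact congrFun (congrFun h (i, a)) (j, b)

theorem realRep_conjTranspose (A : Matrix (Fin n) (Fin n) ℍ[ℝ]) :
    realRep Aᴴ = (realRep A)ᴴ := by
  ext ⟨i, a⟩ ⟨j, b⟩
  simp only [realRep_apply, conjTranspose_apply, star_trivial, quaternionMatrix_apply]
  fin_cases a <;> fin_cases b <;> simp

theorem trace_realRep (A : Matrix (Fin n) (Fin n) ℍ[ℝ]) :
    (realRep A).trace = 4 * A.trace.re := by
  have h : A.trace.re = ∑ i, (A i i).re :=
    map_sum (QuaternionAlgebra.reₗ (-1 : ℝ) 0 (-1)) (fun i => A i i) Finset.univ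
  rw [h, Matrix.trace, Fintype.sum_prod_type, Finset.mul_sum]
  refine Finset.sum_congr rfl fun i _ => ?_
  simp only [diag_apply, realRep_apply, quaternionMatrix_apply, Fin.sum_univ_four]
  simp
  ring

/-- A vector of quaternions as a vector of real coordinates. -/
def realCoords (v : Fin n → ℍ[ℝ]) (p : Fin n × Fin 4) : ℝ :=
  ![(v p.1).re, (v p.1).imI, (v p.1).imJ, (v p.1).imK] p.2

theorem realRep_mulVec (A : Matrix (Fin n) (Fin n) ℍ[ℝ]) (v : Fin n → ℍ[ℝ]) :
    realRep A *ᵥ realCoords v = realCoords (A *ᵥ v) := by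
  have hre : ∀ f : Fin n → ℍ[ℝ], (∑ i, f i).re = ∑ i, (f i).re := fun f =>
    map_sum (QuaternionAlgebra.reₗ (-1 : ℝ) 0 (-1)) f Finset.univ
  have hI : ∀ f : Fin n → ℍ[ℝ], (∑ i, f i).imI = ∑ i, (f i).imI := fun f =>
    map_sum (QuaternionAlgebra.imIₗ (-1 : ℝ) 0 (-1)) f Finset.univ
  have hJ : ∀ f : Fin n → ℍ[ℝ], (∑ i, f i).imJ = ∑ i, (f i).imJ := fun f =>
    map_sum (QuaternionAlgebra.imJₗ (-1 : ℝ) 0 (-1)) f Finset.univ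
  have hK : ∀ f : Fin n → ℍ[ℝ], (∑ i, f i).imK = ∑ i, (f i).imK := fun f =>
    map_sum (QuaternionAlgebra.imKₗ (-1 : ℝ) 0 (-1)) f Finset.univ
  ext ⟨i, a⟩
  simp only [mulVec, dotProduct, Fintype.sum_prod_type, realRep_apply, quaternionMatrix_apply,
    realCoords, hre, hI, hJ, hK, Fin.sum_univ_four]
  fin_cases a <;>
    simp [Finset.sum_add_distrib, Finset.sum_sub_distrib, Finset.sum_neg_distrib] <;> ring

theorem exists_realCoords_eq (u : Fin n × Fin 4 → ℝ) :
    ∃ v : Fin n → ℍ[ℝ], realCoords v = u := by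
  refine ⟨fun i => ⟨u (i, 0), u (i, 1), u (i, 2), u (i, 3)⟩, ?_⟩
  ext ⟨i, a⟩
  fin_cases a <;> simp [realCoords]

/-- The eigenvalues of the real representation of a quaternionic matrix are among the real right
eigenvalues of that matrix. -/
theorem IsQuaternionicPSD.posSemidef_realRep {A : Matrix (Fin n) (Fin n) ℍ[ℝ]}
    (hA : IsQuaternionicPSD A) : (realRep A).PosSemidef := by
  have hH : (realRep A).IsHermitian := by
    rw [Matrix.IsHermitian, ← realRep_conjTranspose, hA.1.eq]
  rw [hH.posSemidef_iff_eigenvalues_nonneg]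
  intro k
  obtain ⟨v, hv⟩ := exists_realCoords_eq (⇑(hH.eigenvectorBasis k))
  have hk := hH.mulVec_eigenvectorBasis k
  rw [← hv, realRep_mulVec] at hk
  refine hA.2 _ ⟨v, ?_, ?_⟩
  · rintro rfl
    have h0 : (⇑(hH.eigenvectorBasis k) : Fin n × Fin 4 → ℝ) = 0 := by
      rw [← hv]
      ext ⟨i, a⟩
      fin_cases a <;> simp [realCoords]
    have h1 := hH.eigenvectorBasis.orthonormal.ne_zero k
    exact h1 (by ext p; exact congrFun h0 p)
  · ext1 i
    have e0 := congrFun hk (i, 0)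
    have e1 := congrFun hk (i, 1)
    have e2 := congrFun hk (i, 2)
    have e3 := congrFun hk (i, 3)
    simp [realCoords] at e0 e1 e2 e3
    refine QuaternionAlgebra.ext ?_ ?_ ?_ ?_ <;> simp [*, mul_comm]

theorem card_fst_eq (i : Fin n) : Fintype.card {q : Fin n × Fin 4 // q.1 = i} = 4 := by
  rw [← Fintype.card_fin 4]
  exact Fintype.card_congr
    { toFun := fun q => q.1.2
      invFun := fun a => ⟨(i, a), rfl⟩
      left_inv := by
        rintro ⟨⟨j, a⟩, rfl⟩
        rfl
      right_inv := fun a => rfl }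

theorem det_toSquareBlockProp_realRep {X : Matrix (Fin n) (Fin n) ℍ[ℝ]} {i : Fin n} {r : ℝ}
    (hi : X i i = (r : ℍ[ℝ])) (hX : ∀ k l, k ≠ i → l ≠ i → X k l = if k = l then 1 else 0) :
    (toSquareBlockProp (realRep X) fun q => q.1 = i).det *
      (toSquareBlockProp (realRep X) fun q => ¬ q.1 = i).det = r ^ 4 := by
  have h1 : toSquareBlockProp (realRep X) (fun q => q.1 = i) = r • 1 := by
    ext ⟨⟨j, a⟩, rfl⟩ ⟨⟨k, b⟩, hk⟩
    obtain rfl : k = j := hk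
    rw [toSquareBlockProp_def, of_apply, realRep_apply, hi, quaternionMatrix_coe]
    simp [Matrix.one_apply]
  have h2 : toSquareBlockProp (realRep X) (fun q => ¬ q.1 = i) = 1 := by
    ext ⟨⟨j, a⟩, hj⟩ ⟨⟨k, b⟩, hk⟩
    rw [toSquareBlockProp_def, of_apply, realRep_apply, hX j k hj hk]
    by_cases hjk : j = k
    · simp [hjk, Matrix.one_apply]
    · simp [hjk]
  rw [h1, h2, det_smul, det_one, det_one, card_fst_eq, mul_one, mul_one]

theorem det_realRep_of_col {X : Matrix (Fin n) (Fin n) ℍ[ℝ]} {i : Fin n} {r : ℝ}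
    (hi : X i i = (r : ℍ[ℝ])) (hX : ∀ k l, l ≠ i → X k l = if k = l then 1 else 0) :
    (realRep X).det = r ^ 4 := by
  rw [twoBlockTriangular_det' _ fun q => q.1 = i,
    det_toSquareBlockProp_realRep hi fun k l _ hl => hX k l hl]
  rintro ⟨j, a⟩ rfl ⟨k, b⟩ hk
  rw [realRep_apply, hX _ _ hk, if_neg (Ne.symm hk)]
  simp

theorem det_realRep_of_row {X : Matrix (Fin n) (Fin n) ℍ[ℝ]} {i : Fin n} {r : ℝ}
    (hi : X i i = (r : ℍ[ℝ])) (hX : ∀ k l, k ≠ i → X k l = if k = l then 1 else 0) :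
    (realRep X).det = r ^ 4 := by
  rw [twoBlockTriangular_det _ fun q => q.1 = i,
    det_toSquareBlockProp_realRep hi fun k l hk _ => hX k l hk]
  rintro ⟨k, b⟩ hk ⟨j, a⟩ rfl
  rw [realRep_apply, hX _ _ hk, if_neg hk]
  simp

end RealRep

/-! ### The Moore determinant of a positive definite matrix -/

section PosDef

open Matrix

variable {n : ℕ}

/-- The matrix that agrees with `A` on `S × S` and with the identity elsewhere. -/
noncomputable def principalPart (A : Matrix (Fin n) (Fin n) ℍ[ℝ]) (S : Finset (Fin n)) :
    Matrix (Fin n) (Fin n) ℍ[ℝ] :=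
  of fun k l => if k ∈ S ∧ l ∈ S then A k l else if k = l then 1 else 0

theorem principalPart_univ (A : Matrix (Fin n) (Fin n) ℍ[ℝ]) :
    principalPart A Finset.univ = A := by
  ext1 k l
  simp [principalPart]

theorem realRep_principalPart (A : Matrix (Fin n) (Fin n) ℍ[ℝ]) (S : Finset (Fin n))
    (p q : Fin n × Fin 4) :
    realRep (principalPart A S) p q =
      if p.1 ∈ S ∧ q.1 ∈ S then realRep A p q else if p = q then 1 else 0 := by
  obtain ⟨k, a⟩ := p
  obtain ⟨l, b⟩ := q
  rw [realRep_apply, principalPart, of_apply]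
  by_cases h : k ∈ S ∧ l ∈ S
  · simp only [h, and_self, if_true]
    rfl
  · by_cases hkl : k = l
    · subst hkl
      simp only [h, if_false, if_true, map_one, Matrix.one_apply, Prod.mk.injEq, true_and]
    · simp [h, hkl]

theorem posDef_realRep_principalPart {A : Matrix (Fin n) (Fin n) ℍ[ℝ]}
    (hA : (realRep A).PosDef) (S : Finset (Fin n)) : (realRep (principalPart A S)).PosDef := by
  have hsymm : ∀ p q, realRep A q p = realRep A p q := fun p q => by
    simpa using congrFun (congrFun hA.1 p) q
  refine PosDef.of_dotProduct_mulVec_pos ?_ fun x hx => ?_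
  · ext p q
    simp only [conjTranspose_apply, star_trivial, realRep_principalPart, hsymm p q,
      and_comm (a := q.1 ∈ S), eq_comm (a := q)]
  · -- The quadratic form splits along the coordinates inside and outside `S`.
    set u : Fin n × Fin 4 → ℝ := fun p => if p.1 ∈ S then x p else 0 with hu
    set w : Fin n × Fin 4 → ℝ := fun p => if p.1 ∈ S then 0 else x p with hw
    have key : star x ⬝ᵥ (realRep (principalPart A S) *ᵥ x) =
        star u ⬝ᵥ (realRep A *ᵥ u) + ∑ p, w p * w p := by
      simp only [dotProduct, mulVec, star_trivial, Finset.mul_sum, realRep_principalPart]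
      rw [← Finset.sum_add_distrib]
      refine Finset.sum_congr rfl fun p _ => ?_
      by_cases hp : p.1 ∈ S
      · simp only [hu, hw, hp, if_true, true_and, mul_zero, add_zero]
        refine Finset.sum_congr rfl fun q _ => ?_
        by_cases hq : q.1 ∈ S
        · simp [hq]
        · have hpq : p ≠ q := fun h => hq (h ▸ hp)
          simp [hq, hpq]
      · simp [hu, hw, hp]
    rw [key]
    have hw0 : 0 ≤ ∑ p, w p * w p := Finset.sum_nonneg fun p _ => mul_self_nonneg _
    by_cases hu0 : u = 0
    · have hwx : w = x := by
        ext p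
        have := congrFun hu0 p
        by_cases hp : p.1 ∈ S
        · simp only [hu, hp, if_true, Pi.zero_apply] at this
          simp [hw, hp, this]
        · simp [hw, hp]
      rw [hu0, hwx]
      obtain ⟨p, hp⟩ := Function.ne_iff.1 hx
      simp only [mulVec_zero, dotProduct_zero, zero_add]
      exact Finset.sum_pos' (fun p _ => mul_self_nonneg _)
        ⟨p, Finset.mem_univ p, mul_self_pos.2 hp⟩
    · exact add_pos_of_pos_of_nonneg (hA.dotProduct_mulVec_pos hu0) hw0

/-- A quaternionic matrix with positive definite real representation is invertible, and its
inverse is of the same kind. -/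
theorem exists_inverse_of_posDef {B : Matrix (Fin n) (Fin n) ℍ[ℝ]} (hB : (realRep B).PosDef) :
    ∃ C : Matrix (Fin n) (Fin n) ℍ[ℝ], B * C = 1 ∧ C * B = 1 ∧ (realRep C).PosDef := by
  have hinj : Function.Injective (LinearMap.mulLeft ℝ B) := by
    refine (injective_iff_map_eq_zero _).2 fun X hX => realRep_injective ?_
    have h : realRep B * realRep X = 0 := by
      rw [← map_mul, show B * X = 0 from hX, map_zero]
    rw [map_zero]
    exact (hB.isUnit.mul_right_eq_zero).1 h
  obtain ⟨C, hC⟩ := LinearMap.injective_iff_surjective.1 hinj 1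
  have h1 : B * C = 1 := hC
  have h2 : realRep B * realRep C = 1 := by rw [← map_mul, h1, map_one]
  refine ⟨C, h1, realRep_injective ?_, ?_⟩
  · rw [map_mul, map_one]
    exact mul_eq_one_comm.1 h2
  · rw [← inv_eq_right_inv h2]
    exact hB.inv

/-- The diagonal entries are real because the real representation is symmetric, while the imaginary
part of an entry is represented by a skew-symmetric block. -/
theorem diag_eq_of_posDef {C : Matrix (Fin n) (Fin n) ℍ[ℝ]} (hC : (realRep C).PosDef)
    (i : Fin n) : C i i = ((C i i).re : ℍ[ℝ]) ∧ 0 < (C i i).re := by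
  have h : ∀ a, realRep C (i, a) (i, 0) = realRep C (i, 0) (i, a) := fun a => by
    simpa using congrFun (congrFun hC.1 (i, 0)) (i, a)
  have h1 := h 1
  have h2 := h 2
  have h3 := h 3
  simp [realRep_apply, quaternionMatrix_apply] at h1 h2 h3
  refine ⟨QuaternionAlgebra.ext ?_ ?_ ?_ ?_, ?_⟩
  · simp
  · simp; linarith
  · simp; linarith
  · simp; linarith
  · have := hC.diag_pos (i := (i, 0))
    simpa [realRep_apply, quaternionMatrix_apply] using this

/-- Cramer's rule for a diagonal entry of the inverse: the ratio of the two determinants is the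
fourth power of that entry. -/
theorem det_realRep_principalPart_erase {A C : Matrix (Fin n) (Fin n) ℍ[ℝ]} {S : Finset (Fin n)}
    {i : Fin n} {r : ℝ} (hi : i ∈ S) (hC : principalPart A S * C = 1)
    (hr : C i i = (r : ℍ[ℝ])) :
    (realRep (principalPart A S)).det * r ^ 4 =
      (realRep (principalPart A (S.erase i))).det := by
  classical
  -- `X` replaces column `i` of the identity by that of `C`; `V` replaces row `i` of the identity
  -- by that of `A`, with entry `1` at `i`.
  set X : Matrix (Fin n) (Fin n) ℍ[ℝ] :=
    of fun k l => if l = i then C k i else if k = l then 1 else 0 with hX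
  set V : Matrix (Fin n) (Fin n) ℍ[ℝ] :=
    of fun k l => if k = i ∧ l ≠ i then principalPart A S i l else if k = l then 1 else 0 with hV
  have hXdet : (realRep X).det = r ^ 4 :=
    det_realRep_of_col (i := i) (by simp [hX, hr]) fun k l hl => by simp [hX, hl]
  have hVdet : (realRep V).det = 1 ^ 4 :=
    det_realRep_of_row (i := i) (by simp [hV]) fun k l hk => by simp [hV, hk]
  have hmul : principalPart A S * X = principalPart A (S.erase i) * V := by
    ext1 k l
    have hLHS : (principalPart A S * X) k l =
        if l = i then (if k = i then 1 else 0) else principalPart A S k l := by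
      by_cases hl : l = i
      · subst hl
        have := congrFun (congrFun hC k) l
        rw [Matrix.mul_apply, Matrix.one_apply] at this
        simp [Matrix.mul_apply, hX, this]
      · simp [Matrix.mul_apply, hX, hl]
    rw [hLHS, Matrix.mul_apply]
    by_cases hk : k = i
    · subst hk
      rw [Finset.sum_eq_single k]
      · by_cases hl : l = k
        · subst hl
          simp [hV, principalPart]
        · simp [hV, principalPart, hl]
      · intro j _ hj
        simp [principalPart, hj.symm]
      · simp
    · rw [Finset.sum_eq_single l]
      · by_cases hl : l = i
        · subst hl
          simp [hV, principalPart, hk]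
        · simp [hV, principalPart, hl, hk]
      · intro j _ hj
        by_cases hji : j = i
        · subst hji
          simp [principalPart, hk]
        · simp [hV, hj, hji]
      · simp
  have hdet := congrArg (fun M => (realRep M).det) hmul
  simpa [map_mul, det_mul, hXdet, hVdet] using hdet

/-- The off-diagonal part of the inverse of a block matrix. -/
theorem inverse_principalPart_apply {A C C' : Matrix (Fin n) (Fin n) ℍ[ℝ]} {S : Finset (Fin n)}
    {i k : Fin n} (hi : i ∈ S) (hki : k ≠ i) (hC : C * principalPart A S = 1)
    (hC' : principalPart A (S.erase i) * C' = 1) :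
    C i k = - (C i i * ∑ j ∈ S.erase i, A i j * C' j k) := by
  have hC'i : C' i k = 0 := by
    have := congrFun (congrFun hC' i) k
    rw [Matrix.mul_apply, Finset.sum_eq_single i, Matrix.one_apply_ne hki.symm] at this
    · simpa [principalPart] using this
    · intro j _ hj
      simp [principalPart, hj.symm]
    · simp
  -- `N` is what is left of `principalPart A S` outside the column `i`.
  set N : Matrix (Fin n) (Fin n) ℍ[ℝ] :=
    of fun l m => if l = i ∧ m ∈ S.erase i then A i m else 0 with hN
  have hcol : (principalPart A S * C') i k =
      ((principalPart A (S.erase i) + N) * C') i k := by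
    simp only [Matrix.mul_apply]
    refine Finset.sum_congr rfl fun j _ => ?_
    by_cases hj : j = i
    · rw [hj, hC'i, mul_zero, mul_zero]
    · by_cases hjS : j ∈ S
      · simp [principalPart, hN, hi, hj, hjS, Ne.symm hj]
      · simp [principalPart, hN, hjS]
  have hrow : ∀ l, l ≠ i → (principalPart A S * C') l k =
      ((principalPart A (S.erase i) + N) * C') l k := by
    intro l hl
    simp only [Matrix.mul_apply]
    refine Finset.sum_congr rfl fun j _ => ?_
    by_cases hj : j = i
    · rw [hj, hC'i, mul_zero, mul_zero]
    · simp [principalPart, hN, hl, hj]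
  have hall : ∀ l, (principalPart A S * C') l k =
      ((principalPart A (S.erase i) + N) * C') l k := fun l => by
    by_cases hl : l = i
    · rw [hl, hcol]
    · exact hrow l hl
  have h0 : (C * (principalPart A S * C')) i k = 0 := by
    rw [← Matrix.mul_assoc, hC, Matrix.one_mul, hC'i]
  have h1 : (C * (principalPart A S * C')) i k = C i k + C i i * (N * C') i k := by
    have hNrow : ∀ l, l ≠ i → (N * C') l k = 0 := fun l hl => by
      simp [Matrix.mul_apply, hN, hl]
    have h2 : (C * (N * C')) i k = C i i * (N * C') i k := by
      rw [Matrix.mul_apply]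
      exact Finset.sum_eq_single i (fun l _ hl => by rw [hNrow l hl, mul_zero]) (by simp)
    have h3 : (C * (principalPart A S * C')) i k =
        (C * ((principalPart A (S.erase i) + N) * C')) i k := by
      rw [Matrix.mul_apply, Matrix.mul_apply]
      exact Finset.sum_congr rfl fun l _ => by rw [hall l]
    rw [h3, Matrix.add_mul, hC', Matrix.mul_add, Matrix.mul_one, Matrix.add_apply, h2]
  have h4 : (N * C') i k = ∑ j ∈ S.erase i, A i j * C' j k := by
    rw [Matrix.mul_apply, ← Finset.sum_subset (Finset.subset_univ (S.erase i))]
    · exact Finset.sum_congr rfl fun j hj => by simp only [hN, of_apply, hj, and_true, if_true]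
    · intro j _ hj
      simp only [hN, of_apply, hj, and_false, if_false, zero_mul]
  rw [h1, h4] at h0
  exact eq_neg_of_add_eq_zero_left h0

theorem inverse_principalPart_eq_zero {A C : Matrix (Fin n) (Fin n) ℍ[ℝ]} {S : Finset (Fin n)}
    {i k : Fin n} (hi : i ∈ S) (hk : k ∉ S) (hC : C * principalPart A S = 1) : C i k = 0 := by
  have h := congrFun (congrFun hC i) k
  have hik : i ≠ k := fun h => hk (h ▸ hi)
  rw [Matrix.mul_apply, Finset.sum_eq_single k, Matrix.one_apply_ne hik] at h
  · simpa [principalPart, hk] using h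
  · intro j _ hj
    simp [principalPart, hk, hj]
  · simp

/-- The expansion along a cycle determines the Moore determinants of all principal submatrices of
a positive definite matrix: they are the positive fourth roots of the real determinants, and the
path sums are the rows of the inverse matrices, scaled by these roots. -/
theorem mooreOn_of_posDef {A : Matrix (Fin n) (Fin n) ℍ[ℝ]}
    {d : Finset (Fin n) → ℝ} (hd0 : ∀ S, 0 < d S)
    (hd : ∀ S, d S ^ 4 = (realRep (principalPart A S)).det)
    {C : Finset (Fin n) → Matrix (Fin n) (Fin n) ℍ[ℝ]}
    (hC : ∀ S, principalPart A S * C S = 1 ∧ C S * principalPart A S = 1 ∧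
      (realRep (C S)).PosDef) (S : Finset (Fin n)) :
    mooreOn A S = (d S : ℍ[ℝ]) ∧ ∀ i ∈ S, ∀ y c,
      pathSum A S i y c = ∑ k, y * ((d S : ℍ[ℝ]) * C S i k) * c k := by
  induction S using Finset.strongInduction with
  | H S ih =>
  have hpath : ∀ i ∈ S, ∀ y c,
      pathSum A S i y c = ∑ k, y * ((d S : ℍ[ℝ]) * C S i k) * c k := by
    intro i hi y c
    obtain ⟨ihm, ihp⟩ := ih (S.erase i) (Finset.erase_ssubset hi)
    obtain ⟨hre, hpos⟩ := diag_eq_of_posDef (hC S).2.2 i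
    have hdiag : (d S : ℍ[ℝ]) * C S i i = (d (S.erase i) : ℍ[ℝ]) := by
      rw [hre, ← Quaternion.coe_mul]
      congr 1
      -- Both sides are positive and have the same fourth power.
      refine (pow_left_inj₀ (mul_pos (hd0 S) hpos).le (hd0 _).le four_ne_zero).1 ?_
      rw [mul_pow, hd, hd]
      exact det_realRep_principalPart_erase hi (hC S).1 hre
    rw [pathSum_eq A hi, ihm, ← Finset.add_sum_erase _ _ (Finset.mem_univ i), hdiag,
      sub_eq_add_neg]
    congr 1
    · rw [Quaternion.coe_commutes]
    · rw [Finset.sum_congr rfl fun j hj => ihp j hj (y * A i j) c, Finset.sum_comm,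
        ← Finset.sum_neg_distrib, ← Finset.add_sum_erase _ _ (Finset.mem_univ i)]
      have hz : ∀ j ∈ S.erase i, C (S.erase i) j i = 0 := fun j hj =>
        inverse_principalPart_eq_zero hj (Finset.notMem_erase i S) (hC (S.erase i)).2.1
      rw [Finset.sum_eq_zero fun j hj => by rw [hz j hj, mul_zero, mul_zero, zero_mul], neg_zero,
        zero_add]
      refine Finset.sum_congr rfl fun k hk => ?_
      rw [inverse_principalPart_apply hi (Finset.ne_of_mem_erase hk) (hC S).2.1
        (hC (S.erase i)).1, mul_neg, ← mul_assoc (d S : ℍ[ℝ]), hdiag, mul_neg, neg_mul,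
        Finset.mul_sum, Finset.mul_sum, Finset.sum_mul]
      congr 1
      refine Finset.sum_congr rfl fun j _ => ?_
      rw [← mul_assoc (d (S.erase i) : ℍ[ℝ]), Quaternion.coe_commutes _ (A i j)]
      simp only [mul_assoc]
  refine ⟨?_, hpath⟩
  rcases S.eq_empty_or_nonempty with rfl | hne
  · rw [mooreOn_empty]
    have h1 : principalPart A ∅ = 1 := by
      ext1 k l
      simp [principalPart, Matrix.one_apply]
    have h2 : d ∅ ^ 4 = 1 := by rw [hd, h1, map_one, det_one]
    rw [(pow_eq_one_iff_of_nonneg (hd0 ∅).le four_ne_zero).1 h2, Quaternion.coe_one]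
  · have hm := S.min'_mem hne
    rw [mooreOn_eq_pathSum A hm fun a ha => S.min'_le a ha, hpath _ hm]
    set m := S.min' hne
    have h := congrFun (congrFun (hC S).2.1 m) m
    rw [Matrix.mul_apply, Matrix.one_apply_eq] at h
    have hterm : ∀ k, 1 * ((d S : ℍ[ℝ]) * C S m k) * A k m =
        (d S : ℍ[ℝ]) * (C S m k * principalPart A S k m) := fun k => by
      by_cases hk : k ∈ S
      · simp [principalPart, hk, hm, mul_assoc]
      · simp [inverse_principalPart_eq_zero hm hk (hC S).2.1]
    rw [Finset.sum_congr rfl fun k _ => hterm k, ← Finset.mul_sum, h, mul_one]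

/-- The Moore determinant of a positive definite matrix is real and positive, and its fourth power
is the determinant of the real representation. -/
theorem exists_mooreDet_eq_of_posDef {A : Matrix (Fin n) (Fin n) ℍ[ℝ]}
    (hA : (realRep A).PosDef) :
    ∃ d : ℝ, 0 < d ∧ mooreDet A = (d : ℍ[ℝ]) ∧ d ^ 4 = (realRep A).det := by
  choose C hC using fun S => exists_inverse_of_posDef (posDef_realRep_principalPart hA S)
  have hpos : ∀ S, 0 < (realRep (principalPart A S)).det := fun S =>
    (posDef_realRep_principalPart hA S).det_pos
  have hroot : ∀ S, ∃ d : ℝ, 0 < d ∧ d ^ 4 = (realRep (principalPart A S)).det := fun S =>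
    ⟨_, Real.rpow_pos_of_pos (hpos S) _,
      Real.rpow_inv_natCast_pow (hpos S).le (n := 4) four_ne_zero⟩
  choose d hd0 hd using hroot
  refine ⟨d Finset.univ, hd0 _, ?_, ?_⟩
  · rw [← mooreOn_univ]
    exact (mooreOn_of_posDef hd0 hd hC Finset.univ).1
  · rw [hd, principalPart_univ]

end PosDef

/-! ### Determinants of pencils of positive semidefinite matrices -/

section Pencil

open Matrix
open scoped ComplexOrder MatrixOrder

variable {ι m : Type*} [Fintype ι] [Fintype m] [DecidableEq m]

theorem posDef_sum_smul {K : ι → Matrix m m ℝ} (hK : ∀ i, (K i).PosSemidef) (h1 : ∑ i, K i = 1)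
    {x : ι → ℝ} (hx : ∀ i, 0 < x i) : (∑ i, x i • K i).PosDef := by
  refine PosDef.of_dotProduct_mulVec_pos
    (posSemidef_sum _ fun i _ => (hK i).smul (hx i).le).1 fun u hu => ?_
  have hpos : 0 < ∑ i, star u ⬝ᵥ (K i *ᵥ u) := by
    rw [← dotProduct_sum, ← sum_mulVec, h1, one_mulVec]
    exact dotProduct_star_self_pos_iff.2 hu
  have hnn : ∀ i, 0 ≤ star u ⬝ᵥ (K i *ᵥ u) := fun i => (hK i).dotProduct_mulVec_nonneg u
  obtain ⟨i, -, hi⟩ := Finset.exists_lt_of_sum_lt (f := fun _ : ι => (0 : ℝ)) (s := Finset.univ)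
    (by simpa using hpos)
  rw [sum_mulVec, dotProduct_sum]
  simp only [smul_mulVec, dotProduct_smul, smul_eq_mul]
  exact Finset.sum_pos' (fun j _ => mul_nonneg (hx j).le (hnn j))
    ⟨i, Finset.mem_univ i, mul_pos (hx i) hi⟩

theorem Matrix.PosSemidef.map_ofReal {K : Matrix m m ℝ} (hK : K.PosSemidef) :
    (K.map (algebraMap ℝ ℂ)).PosSemidef := by
  obtain ⟨B, rfl⟩ := CStarAlgebra.nonneg_iff_eq_star_mul_self.mp hK.nonneg
  have h : (star B * B).map (algebraMap ℝ ℂ) =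
      (B.map (algebraMap ℝ ℂ))ᴴ * B.map (algebraMap ℝ ℂ) := by
    rw [Matrix.map_mul]
    congr 1
    ext i j
    simp
  rw [h]
  exact posSemidef_conjTranspose_mul_self _

/-- The pencil is invertible on the right half-plane, because the real part of its quadratic form
is positive there. -/
theorem det_sum_smul_ne_zero {K : ι → Matrix m m ℝ} (hK : ∀ i, (K i).PosSemidef)
    (h1 : ∑ i, K i = 1) {z : ι → ℂ} (hz : ∀ i, 0 < (z i).re) :
    (∑ i, z i • (K i).map (algebraMap ℝ ℂ)).det ≠ 0 := by
  intro h
  obtain ⟨v, hv, hv0⟩ := exists_mulVec_eq_zero_iff.2 h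
  set q : ι → ℂ := fun i => star v ⬝ᵥ ((K i).map (algebraMap ℝ ℂ) *ᵥ v) with hq
  have hnn : ∀ i, 0 ≤ q i := fun i => (hK i).map_ofReal.dotProduct_mulVec_nonneg v
  have hsum : ∑ i, q i = star v ⬝ᵥ v := by
    have h1' : ∑ i, (K i).map (algebraMap ℝ ℂ) = 1 := by
      have := congrArg (algebraMap ℝ ℂ).mapMatrix h1
      rw [map_sum, map_one] at this
      exact this
    rw [hq, ← dotProduct_sum, ← sum_mulVec, h1', one_mulVec]
  have hpos : 0 < (∑ i, q i).re := by
    rw [hsum]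
    exact (Complex.pos_iff.1 (dotProduct_star_self_pos_iff.2 hv)).1
  have hzero : ∑ i, z i * q i = 0 := by
    have := congrArg (fun w => star v ⬝ᵥ w) hv0
    simpa only [sum_mulVec, dotProduct_sum, smul_mulVec, dotProduct_smul, smul_eq_mul,
      dotProduct_zero] using this
  rw [Complex.re_sum] at hpos
  obtain ⟨i, -, hi⟩ := Finset.exists_lt_of_sum_lt (f := fun _ : ι => (0 : ℝ)) (s := Finset.univ)
    (by simpa using hpos)
  have hre : ∀ j, (z j * q j).re = (z j).re * (q j).re := fun j => by
    rw [Complex.mul_re, ← (Complex.nonneg_iff.1 (hnn j)).2, mul_zero, sub_zero]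
  have : 0 < (∑ j, z j * q j).re := by
    rw [Complex.re_sum]
    simp only [hre]
    exact Finset.sum_pos' (fun j _ => mul_nonneg (hz j).le (Complex.nonneg_iff.1 (hnn j)).1)
      ⟨i, Finset.mem_univ i, mul_pos (hz i) hi⟩
  rw [hzero] at this
  exact lt_irrefl _ this

/-- In an eigenbasis of the pencil every eigenvalue is a weighted arithmetic mean of the `x i`,
and the weights of `x i` add up to the trace of `K i`; the bound is the weighted inequality of
arithmetic and geometric means. -/
theorem prod_pow_le_det_sum_smul {K : ι → Matrix m m ℝ} (hK : ∀ i, (K i).PosSemidef)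
    (h1 : ∑ i, K i = 1) {t : ℕ} (ht : ∀ i, (K i).trace = t) {x : ι → ℝ} (hx : ∀ i, 0 < x i) :
    (∏ i, x i) ^ t ≤ (∑ i, x i • K i).det := by
  have hS := (posDef_sum_smul hK h1 hx).1
  set U : Matrix m m ℝ := (hS.eigenvectorUnitary : Matrix m m ℝ) with hU
  have hU1 : star U * U = 1 := Unitary.coe_star_mul_self _
  have hU2 : U * star U = 1 := Unitary.coe_mul_star_self _
  set W : ι → Matrix m m ℝ := fun i => star U * K i * U with hW
  have hWpsd : ∀ i, (W i).PosSemidef := fun i => (hK i).conjTranspose_mul_mul_same U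
  have hW1 : ∑ i, W i = 1 := by
    rw [hW, ← Finset.sum_mul, ← Finset.mul_sum, h1, mul_one, hU1]
  have hWt : ∀ i, ∑ j, W i j j = t := fun i => by
    rw [← ht i]
    change (star U * K i * U).trace = _
    rw [Matrix.trace_mul_comm, ← Matrix.mul_assoc, hU2, Matrix.one_mul]
  have hdiag : ∑ i, x i • W i = diagonal hS.eigenvalues := by
    have h := hS.conjStarAlgAut_star_eigenvectorUnitary
    rw [Unitary.conjStarAlgAut_star_apply] at h
    have h2 : ∑ i, x i • W i = star U * (∑ i, x i • K i) * U := by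
      simp only [hW, Finset.mul_sum, Finset.sum_mul, Matrix.mul_smul, Matrix.smul_mul]
    rw [h2]
    exact h
  have hev : ∀ j, hS.eigenvalues j = ∑ i, W i j j * x i := fun j => by
    have := congrFun (congrFun hdiag j) j
    rw [diagonal_apply_eq, Matrix.sum_apply] at this
    rw [← this]
    exact Finset.sum_congr rfl fun i _ => by rw [Matrix.smul_apply, smul_eq_mul, mul_comm]
  have hle : ∀ j, ∏ i, x i ^ W i j j ≤ hS.eigenvalues j := fun j => by
    rw [hev]
    refine Real.geom_mean_le_arith_mean_weighted _ _ _ (fun i _ => (hWpsd i).diag_nonneg) ?_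
      fun i _ => (hx i).le
    have := congrFun (congrFun hW1 j) j
    rwa [Matrix.sum_apply, Matrix.one_apply_eq] at this
  rw [hS.det_eq_prod_eigenvalues]
  calc (∏ i, x i) ^ t = ∏ i, ∏ j, x i ^ W i j j := by
        rw [← Finset.prod_pow]
        refine Finset.prod_congr rfl fun i _ => ?_
        rw [← Real.rpow_sum_of_pos (hx i), hWt, Real.rpow_natCast]
    _ = ∏ j, ∏ i, x i ^ W i j j := Finset.prod_comm
    _ ≤ _ := Finset.prod_le_prod
        (fun j _ => Finset.prod_nonneg fun i _ => Real.rpow_nonneg (hx i).le _) fun j _ => hle j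

/-- The determinant of a pencil as a polynomial in its parameters. -/
noncomputable def pencilDet (K : ι → Matrix m m ℝ) : MvPolynomial ι ℝ :=
  (∑ i, (MvPolynomial.X i : MvPolynomial ι ℝ) • (K i).map MvPolynomial.C).det

theorem aeval_pencilDet {R : Type*} [CommRing R] [Algebra ℝ R] (K : ι → Matrix m m ℝ)
    (z : ι → R) :
    MvPolynomial.aeval z (pencilDet K) = (∑ i, z i • (K i).map (algebraMap ℝ R)).det := by
  rw [pencilDet, AlgHom.map_det]
  congr 1
  ext a b
  simp [Matrix.sum_apply]

end Pencil

/-! ### The Moore determinant of a pencil as a polynomial -/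

section Polynomial

open MvPolynomial

variable {n : ℕ}

/-- A quaternion-valued function whose four components are homogeneous real polynomials of
degree `k`. -/
def IsHomogeneousMap (k : ℕ) (f : (Fin n → ℝ) → ℍ[ℝ]) : Prop :=
  ∃ p q r s : MvPolynomial (Fin n) ℝ, (p.IsHomogeneous k ∧ q.IsHomogeneous k ∧
    r.IsHomogeneous k ∧ s.IsHomogeneous k) ∧
    ∀ x, (f x).re = eval x p ∧ (f x).imI = eval x q ∧ (f x).imJ = eval x r ∧
      (f x).imK = eval x s

namespace IsHomogeneousMap

theorem const (a : ℍ[ℝ]) : IsHomogeneousMap 0 fun _ : Fin n → ℝ => a :=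
  ⟨C a.re, C a.imI, C a.imJ, C a.imK, ⟨isHomogeneous_C _ _, isHomogeneous_C _ _,
    isHomogeneous_C _ _, isHomogeneous_C _ _⟩, fun x => by simp⟩

theorem zero (k : ℕ) : IsHomogeneousMap k fun _ : Fin n → ℝ => 0 :=
  ⟨0, 0, 0, 0, ⟨isHomogeneous_zero _ _ _, isHomogeneous_zero _ _ _, isHomogeneous_zero _ _ _,
    isHomogeneous_zero _ _ _⟩, fun x => by simp⟩

theorem coord (i : Fin n) (a : ℍ[ℝ]) : IsHomogeneousMap 1 fun x : Fin n → ℝ => x i • a :=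
  ⟨C a.re * X i, C a.imI * X i, C a.imJ * X i, C a.imK * X i, ⟨isHomogeneous_C_mul_X _ _,
    isHomogeneous_C_mul_X _ _, isHomogeneous_C_mul_X _ _, isHomogeneous_C_mul_X _ _⟩, fun x => by simp [mul_comm]⟩

theorem add {k : ℕ} {f g : (Fin n → ℝ) → ℍ[ℝ]} (hf : IsHomogeneousMap k f)
    (hg : IsHomogeneousMap k g) : IsHomogeneousMap k fun x => f x + g x := by
  obtain ⟨p, q, r, s, ⟨hp, hq, hr, hs⟩, hfx⟩ := hf
  obtain ⟨p', q', r', s', ⟨hp', hq', hr', hs'⟩, hgx⟩ := hg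
  refine ⟨p + p', q + q', r + r', s + s', ⟨hp.add hp', hq.add hq', hr.add hr', hs.add hs'⟩,
    fun x => ?_⟩
  simp [hfx x, hgx x]

theorem neg {k : ℕ} {f : (Fin n → ℝ) → ℍ[ℝ]} (hf : IsHomogeneousMap k f) :
    IsHomogeneousMap k fun x => -f x := by
  obtain ⟨p, q, r, s, ⟨hp, hq, hr, hs⟩, hfx⟩ := hf
  refine ⟨-p, -q, -r, -s, ⟨hp.neg, hq.neg, hr.neg, hs.neg⟩, fun x => ?_⟩
  simp [hfx x]

theorem sub {k : ℕ} {f g : (Fin n → ℝ) → ℍ[ℝ]} (hf : IsHomogeneousMap k f)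
    (hg : IsHomogeneousMap k g) : IsHomogeneousMap k fun x => f x - g x := by
  simpa only [sub_eq_add_neg] using hf.add hg.neg

theorem sum {ι : Type*} {k : ℕ} {s : Finset ι} {f : ι → (Fin n → ℝ) → ℍ[ℝ]}
    (hf : ∀ i ∈ s, IsHomogeneousMap k (f i)) : IsHomogeneousMap k fun x => ∑ i ∈ s, f i x := by
  classical
  induction s using Finset.induction_on with
  | empty => simpa using zero k
  | insert i s hi ih =>
    simp only [Finset.sum_insert hi]
    exact (hf i (Finset.mem_insert_self i s)).add
      (ih fun j hj => hf j (Finset.mem_insert_of_mem hj))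

theorem mul {k l : ℕ} {f g : (Fin n → ℝ) → ℍ[ℝ]} (hf : IsHomogeneousMap k f)
    (hg : IsHomogeneousMap l g) : IsHomogeneousMap (k + l) fun x => f x * g x := by
  obtain ⟨p, q, r, s, ⟨hp, hq, hr, hs⟩, hfx⟩ := hf
  obtain ⟨p', q', r', s', ⟨hp', hq', hr', hs'⟩, hgx⟩ := hg
  refine ⟨p * p' - q * q' - r * r' - s * s', p * q' + q * p' + r * s' - s * r',
    p * r' - q * s' + r * p' + s * q', p * s' + q * r' - r * q' + s * p',
    ⟨(((hp.mul hp').sub (hq.mul hq')).sub (hr.mul hr')).sub (hs.mul hs'),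
      (((hp.mul hq').add (hq.mul hp')).add (hr.mul hs')).sub (hs.mul hr'),
      (((hp.mul hr').sub (hq.mul hs')).add (hr.mul hp')).add (hs.mul hq'),
      (((hp.mul hs').add (hq.mul hr')).sub (hr.mul hq')).add (hs.mul hp')⟩, fun x => ?_⟩
  simp [hfx x, hgx x]

end IsHomogeneousMap

/-- The expansion along a cycle lowers the size of the index set by one and uses up one factor that
is linear in the parameters. -/
theorem isHomogeneousMap_mooreOn {A : (Fin n → ℝ) → Matrix (Fin n) (Fin n) ℍ[ℝ]}
    (hA : ∀ i j, IsHomogeneousMap 1 fun x => A x i j) (S : Finset (Fin n)) :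
    IsHomogeneousMap S.card (fun x => mooreOn (A x) S) ∧
      ∀ i ∈ S, ∀ (k : ℕ) (y : (Fin n → ℝ) → ℍ[ℝ]) (c : (Fin n → ℝ) → Fin n → ℍ[ℝ]),
        IsHomogeneousMap k y → (∀ j, IsHomogeneousMap 1 fun x => c x j) →
        IsHomogeneousMap (k + S.card) fun x => pathSum (A x) S i (y x) (c x) := by
  induction S using Finset.strongInduction with
  | H S ih =>
  have hpath : ∀ i ∈ S, ∀ (k : ℕ) (y : (Fin n → ℝ) → ℍ[ℝ]) (c : (Fin n → ℝ) → Fin n → ℍ[ℝ]),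
        IsHomogeneousMap k y → (∀ j, IsHomogeneousMap 1 fun x => c x j) →
        IsHomogeneousMap (k + S.card) fun x => pathSum (A x) S i (y x) (c x) := by
    intro i hi k y c hy hc
    obtain ⟨ihm, ihp⟩ := ih (S.erase i) (Finset.erase_ssubset hi)
    have hcard := Finset.card_erase_add_one hi
    simp only [pathSum_eq _ hi]
    refine IsHomogeneousMap.sub ?_ (IsHomogeneousMap.sum fun j hj => ?_)
    · have := (ihm.mul hy).mul (hc i)
      rwa [show (S.erase i).card + k + 1 = k + S.card by omega] at this
    · have := ihp j hj (k + 1) _ c (hy.mul (hA i j)) hc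
      rwa [show k + 1 + (S.erase i).card = k + S.card by omega] at this
  refine ⟨?_, hpath⟩
  rcases S.eq_empty_or_nonempty with rfl | hne
  · simp only [mooreOn_empty]
    exact IsHomogeneousMap.const 1
  · have hm := S.min'_mem hne
    simp only [mooreOn_eq_pathSum _ hm fun a ha => S.min'_le a ha]
    have := hpath _ hm 0 _ _ (IsHomogeneousMap.const 1) fun j => hA j (S.min' hne)
    rwa [zero_add] at this

theorem isHomogeneousMap_mooreDet (H : Fin n → Matrix (Fin n) (Fin n) ℍ[ℝ]) :
    IsHomogeneousMap n fun x => mooreDet (∑ i, x i • H i) := by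
  have h := (isHomogeneousMap_mooreOn (A := fun x => ∑ i, x i • H i) (fun j k => by
    simp only [Matrix.sum_apply, Matrix.smul_apply]
    exact IsHomogeneousMap.sum fun i _ => IsHomogeneousMap.coord i _) Finset.univ).1
  simpa only [mooreOn_univ, Finset.card_univ, Fintype.card_fin] using h

/-- Polynomials that agree on the positive orthant are equal. -/
theorem MvPolynomial.eq_of_eval_eq_of_pos {p q : MvPolynomial (Fin n) ℝ}
    (h : ∀ x : Fin n → ℝ, (∀ i, 0 < x i) → eval x p = eval x q) : p = q :=
  funext_set (fun _ => Set.Ioi 0) (fun _ => Set.Ioi_infinite 0) fun x hx =>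
    h x fun i => hx i (Set.mem_univ i)

/-- For a doubly stochastic tuple the Moore determinant of the pencil is a real homogeneous
polynomial, whose fourth power is the determinant of the real pencil. Both facts hold on the
positive orthant, where the pencil is positive definite, hence everywhere. -/
theorem exists_polynomial_mooreDet {H : Fin n → Matrix (Fin n) (Fin n) ℍ[ℝ]}
    (hH : IsDoublyStochasticTuple H) :
    ∃ p : MvPolynomial (Fin n) ℝ, p.IsHomogeneous n ∧
      (∀ x, mooreDet (∑ i, x i • H i) = ((eval x p : ℝ) : ℍ[ℝ])) ∧
      (∀ x : Fin n → ℝ, (∀ i, 0 < x i) → 0 < eval x p) ∧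
      p ^ 4 = pencilDet fun i => realRep (H i) := by
  obtain ⟨p, q, r, s, ⟨hp, hq, hr, hs⟩, hfx⟩ := isHomogeneousMap_mooreDet H
  have hpsd : ∀ i, (realRep (H i)).PosSemidef := fun i => (hH.psd i).posSemidef_realRep
  have hone : ∑ i, realRep (H i) = 1 := by rw [← map_sum, hH.sum_eq_one, map_one]
  have hrep : ∀ x : Fin n → ℝ, realRep (∑ i, x i • H i) = ∑ i, x i • realRep (H i) := fun x => by
    simp only [map_sum, map_smul]
  have hpd : ∀ x : Fin n → ℝ, (∀ i, 0 < x i) →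
      0 < eval x p ∧ eval x q = 0 ∧ eval x r = 0 ∧ eval x s = 0 ∧
        eval x p ^ 4 = (∑ i, x i • realRep (H i)).det := fun x hx => by
    obtain ⟨d, hd0, hd, hd4⟩ := exists_mooreDet_eq_of_posDef
      (A := ∑ i, x i • H i) (hrep x ▸ posDef_sum_smul hpsd hone hx)
    obtain ⟨e0, e1, e2, e3⟩ := hfx x
    simp only [hd, Quaternion.re_coe, Quaternion.imI_coe, Quaternion.imJ_coe,
      Quaternion.imK_coe] at e0 e1 e2 e3
    exact ⟨e0 ▸ hd0, e1.symm, e2.symm, e3.symm, by rw [← e0, hd4, hrep]⟩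
  have hq0 : q = 0 := eq_of_eval_eq_of_pos fun x hx => by rw [(hpd x hx).2.1, map_zero]
  have hr0 : r = 0 := eq_of_eval_eq_of_pos fun x hx => by rw [(hpd x hx).2.2.1, map_zero]
  have hs0 : s = 0 := eq_of_eval_eq_of_pos fun x hx => by rw [(hpd x hx).2.2.2.1, map_zero]
  refine ⟨p, hp, fun x => ?_, fun x hx => (hpd x hx).1, eq_of_eval_eq_of_pos fun x hx => ?_⟩
  · obtain ⟨e0, e1, e2, e3⟩ := hfx x
    rw [hq0, map_zero] at e1
    rw [hr0, map_zero] at e2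
    rw [hs0, map_zero] at e3
    exact QuaternionAlgebra.ext e0 e1 e2 e3
  · rw [map_pow, (hpd x hx).2.2.2.2, ← coe_aeval_eq_eval, RingHom.coe_coe, aeval_pencilDet]
    rfl

end Polynomial

/-! ### Univariate polynomials with negative roots -/

section Univariate

open Polynomial

/-- The inequality of arithmetic and geometric means for a multiset with mean `M`, from the tangent
bound `u ≤ M * exp (u / M - 1)`. -/
theorem Multiset.prod_le_pow_of_sum_eq {s : Multiset ℝ} {M : ℝ} (hM : 0 < M)
    (hs : ∀ u ∈ s, 0 ≤ u) (hsum : s.sum = s.card * M) : s.prod ≤ M ^ s.card := by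
  have key : ∀ t : Multiset ℝ, (∀ u ∈ t, 0 ≤ u) →
      t.prod ≤ M ^ t.card * Real.exp (t.sum / M - t.card) := by
    intro t
    induction t using Multiset.induction_on with
    | empty => simp
    | cons u t ih =>
      intro ht
      have hu : u ≤ M * Real.exp (u / M - 1) := by
        have := Real.add_one_le_exp (u / M - 1)
        rw [sub_add_cancel, div_le_iff₀ hM] at this
        linarith
      rw [Multiset.prod_cons, Multiset.card_cons, Multiset.sum_cons]
      calc u * t.prod ≤ (M * Real.exp (u / M - 1)) *
              (M ^ t.card * Real.exp (t.sum / M - t.card)) :=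
            mul_le_mul hu (ih fun v hv => ht v (Multiset.mem_cons_of_mem hv))
              (Multiset.prod_nonneg fun v hv => ht v (Multiset.mem_cons_of_mem hv))
              (by positivity)
        _ = M ^ (t.card + 1) *
              (Real.exp (u / M - 1) * Real.exp (t.sum / M - t.card)) := by ring
        _ = _ := by
            rw [← Real.exp_add]
            congr 2
            push_cast
            ring
  have h := key s hs
  rwa [hsum, mul_div_assoc, div_self hM.ne', mul_one, sub_self, Real.exp_zero, mul_one] at h

/-- A polynomial of degree `d + 1` with negative roots which dominates `C * t` on the positive
half-line has linear coefficient at least `C * (d / (d + 1)) ^ d`: by the inequality of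
arithmetic and geometric means it is at most `f(0) * (1 + s * t / (d + 1)) ^ (d + 1)`, where
`f(0) * s` is the linear coefficient, and this bound is compared with `C * t` at the point
`t = (d + 1) / (d * s)`. -/
theorem Polynomial.le_coeff_one_of_roots_neg {f : ℝ[X]} {d : ℕ} (hd : d ≠ 0)
    (hdeg : f.natDegree = d + 1) (h0 : 0 < f.eval 0)
    (hroots : ∀ z : ℂ, aeval z f = 0 → z.im = 0 ∧ z.re < 0) {C : ℝ}
    (hC : ∀ t : ℝ, 0 < t → C * t ≤ f.eval t) :
    C * ((d : ℝ) / (d + 1)) ^ d ≤ f.coeff 1 := by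
  have hsplit : f.Splits := by
    refine Splits.of_splits_map (algebraMap ℝ ℂ) (IsAlgClosed.splits _) fun z hz => ?_
    have hz0 : aeval z f = 0 := by
      rw [aeval_def, ← eval_map]
      exact (mem_roots'.1 hz).2
    exact ⟨z.re, Complex.ext (by simp) (by simp [(hroots z hz0).1])⟩
  have hneg : ∀ r ∈ f.roots, r < 0 := fun r hr => by
    have h : aeval (r : ℂ) f = 0 := by
      rw [show (r : ℂ) = algebraMap ℝ ℂ r from rfl, aeval_algebraMap_apply_eq_algebraMap_eval,
        (mem_roots'.1 hr).2, map_zero]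
    exact (hroots r h).2
  have hcard : f.roots.card = d + 1 := by rw [← hdeg, hsplit.natDegree_eq_card_roots]
  set s : ℝ := (f.roots.map fun r => 1 / (0 - r)).sum with hs
  have hcoeff : f.coeff 1 = f.eval 0 * s := by
    rw [← hsplit.eval_derivative_eq_eval_mul_sum h0.ne', ← coeff_zero_eq_eval_zero,
      coeff_derivative]
    simp
  have hspos : 0 < s := by
    have hne : f.roots ≠ 0 := fun h => by simp [h] at hcard
    obtain ⟨r, hr⟩ := Multiset.exists_mem_of_ne_zero hne
    refine lt_of_lt_of_le (one_div_pos.2 (sub_pos.2 (hneg r hr)))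
      (Multiset.single_le_sum ?_ _ (Multiset.mem_map_of_mem _ hr))
    intro x hx
    obtain ⟨r', hr', rfl⟩ := Multiset.mem_map.1 hx
    exact (one_div_pos.2 (sub_pos.2 (hneg r' hr'))).le
  have heval : ∀ t, f.eval t = f.eval 0 * (f.roots.map fun r => 1 + t * (1 / (0 - r))).prod := by
    intro t
    rw [hsplit.eval_eq_prod_roots t, hsplit.eval_eq_prod_roots 0, mul_assoc,
      ← Multiset.prod_map_mul]
    congr 2
    refine Multiset.map_congr rfl fun r hr => ?_
    have := (hneg r hr).ne
    rw [zero_sub]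
    field_simp
    ring
  have hd0 : (0 : ℝ) < d := by exact_mod_cast Nat.pos_of_ne_zero hd
  have hle : ∀ t, 0 < t → t * s = (d + 1) / d →
      f.eval t ≤ f.eval 0 * (((d : ℝ) + 1) / d) ^ (d + 1) := by
    intro t ht hts
    rw [heval]
    refine mul_le_mul_of_nonneg_left ?_ h0.le
    have hM : (0 : ℝ) < ((d : ℝ) + 1) / d := by positivity
    have hc : (f.roots.map fun r => 1 + t * (1 / (0 - r))).card = d + 1 := by
      rw [Multiset.card_map, hcard]
    have h := Multiset.prod_le_pow_of_sum_eq
      (s := f.roots.map fun r => 1 + t * (1 / (0 - r))) hM ?_ ?_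
    · rwa [hc] at h
    · intro u hu
      obtain ⟨r, hr, rfl⟩ := Multiset.mem_map.1 hu
      have := one_div_pos.2 (sub_pos.2 (hneg r hr))
      positivity
    · rw [hc, Multiset.sum_map_add, Multiset.sum_map_mul_left, ← hs, hts, Multiset.map_const',
        Multiset.sum_replicate, hcard]
      push_cast
      rw [nsmul_eq_mul]
      push_cast
      field_simp
  have ht : 0 < (d + 1) / (d * s) := by positivity
  have h := (hC _ ht).trans (hle _ ht (by field_simp))
  rw [hcoeff]
  have hinv : ((d : ℝ) / (d + 1)) ^ d = ((((d : ℝ) + 1) / d) ^ d)⁻¹ := by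
    rw [← inv_pow, inv_div]
  have hM : (0 : ℝ) < (((d : ℝ) + 1) / d) ^ d := by positivity
  rw [hinv, ← div_eq_mul_inv, div_le_iff₀ hM]
  have h2 : C * ((d + 1) / (d * s)) * (d * s / (d + 1)) ≤
      f.eval 0 * (((d : ℝ) + 1) / d) ^ (d + 1) * (d * s / (d + 1)) :=
    mul_le_mul_of_nonneg_right h (by positivity)
  calc C = C * ((d + 1) / (d * s)) * (d * s / (d + 1)) := by field_simp
    _ ≤ _ := h2
    _ = f.eval 0 * s * (((d : ℝ) + 1) / d) ^ d := by
      rw [pow_succ]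
      field_simp

theorem Multiset.re_sum_pos {s : Multiset ℂ} (hs : s ≠ 0) (h : ∀ z ∈ s, 0 < z.re) :
    0 < s.sum.re := by
  have key : ∀ t : Multiset ℂ, (∀ z ∈ t, 0 < z.re) → 0 ≤ t.sum.re := fun t => by
    induction t using Multiset.induction_on with
    | empty => simp
    | cons z t ih =>
      intro ht
      rw [Multiset.sum_cons, Complex.add_re]
      exact add_nonneg (ht z (Multiset.mem_cons_self z t)).le
        (ih fun w hw => ht w (Multiset.mem_cons_of_mem hw))
  obtain ⟨z, hz⟩ := Multiset.exists_mem_of_ne_zero hs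
  obtain ⟨t, rfl⟩ := Multiset.exists_cons_of_mem hz
  rw [Multiset.sum_cons, Complex.add_re]
  exact add_pos_of_pos_of_nonneg (h z hz) (key t fun w hw => h w (Multiset.mem_cons_of_mem hw))

/-- The logarithmic derivative at `0` is the sum of `1 / (-r)` over the roots `r`, and each of these
terms has positive real part when `r` lies in the open left half-plane. -/
theorem Polynomial.coeff_one_ne_zero_of_roots_re_neg {g : ℂ[X]} (hdeg : g.natDegree ≠ 0)
    (h : ∀ z, 0 ≤ z.re → g.eval z ≠ 0) : g.coeff 1 ≠ 0 := by
  have hsplit : g.Splits := IsAlgClosed.splits g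
  have h0 : g.eval 0 ≠ 0 := h 0 le_rfl
  have hcoeff : g.coeff 1 = g.eval 0 * (g.roots.map fun r => 1 / (0 - r)).sum := by
    rw [← hsplit.eval_derivative_eq_eval_mul_sum h0, ← coeff_zero_eq_eval_zero,
      coeff_derivative]
    simp
  have hpos : 0 < (g.roots.map fun r => 1 / (0 - r)).sum.re := by
    refine Multiset.re_sum_pos (fun he => hdeg ?_) fun z hz => ?_
    · rw [hsplit.natDegree_eq_card_roots, Multiset.map_eq_zero.1 he, Multiset.card_zero]
    · obtain ⟨r, hr, rfl⟩ := Multiset.mem_map.1 hz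
      have hre : r.re < 0 := by
        by_contra! hc
        exact h r hc (mem_roots'.1 hr).2
      have hr0 : r ≠ 0 := fun h => by simp [h] at hre
      rw [one_div, Complex.inv_re, zero_sub, Complex.neg_re, Complex.normSq_neg]
      exact div_pos (neg_pos.2 hre) (Complex.normSq_pos.2 hr0)
  rw [hcoeff]
  refine mul_ne_zero h0 fun hz => ?_
  rw [hz] at hpos
  exact lt_irrefl _ hpos

end Univariate

/-! ### Stable polynomials and their capacity -/

section Stable

open MvPolynomial

/-- A real polynomial without zeros in the product of the open right half-planes. -/
def IsStable {ι : Type*} (f : MvPolynomial ι ℝ) : Prop :=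
  ∀ z : ι → ℂ, (∀ i, 0 < (z i).re) → aeval z f ≠ 0

/-- A real polynomial without zeros in the product of the closed right half-planes, except where
all variables are purely imaginary. -/
def IsStrictlyStable {ι : Type*} (f : MvPolynomial ι ℝ) : Prop :=
  ∀ z : ι → ℂ, (∀ i, 0 ≤ (z i).re) → (∃ i, 0 < (z i).re) → aeval z f ≠ 0

theorem MvPolynomial.aeval_eq_eval_apply {ι : Type*} (x : ι → ℝ) (f : MvPolynomial ι ℝ) :
    aeval x f = eval x f := by
  rw [← coe_aeval_eq_eval]
  rfl

theorem MvPolynomial.IsHomogeneous.aeval_smul {ι R : Type*} [CommRing R] [Algebra ℝ R]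
    {f : MvPolynomial ι ℝ} {D : ℕ} (hf : f.IsHomogeneous D) (t : R) (z : ι → R) :
    MvPolynomial.aeval (fun i => t * z i) f = t ^ D * MvPolynomial.aeval z f := by
  rw [aeval_def, aeval_def, eval₂_eq, eval₂_eq, Finset.mul_sum]
  refine Finset.sum_congr rfl fun d hd => ?_
  rw [hf.degree_eq_sum_deg_support hd, ← Finset.prod_pow_eq_pow_sum]
  simp only [mul_pow, Finset.prod_mul_distrib]
  ring

theorem MvPolynomial.aeval_cons {R : Type*} [CommRing R] [Algebra ℝ R] {m : ℕ} (t : R)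
    (z : Fin m → R) (f : MvPolynomial (Fin (m + 1)) ℝ) :
    aeval (Fin.cons t z : Fin (m + 1) → R) f =
      ((finSuccEquiv ℝ m f).map (aeval z : MvPolynomial (Fin m) ℝ →ₐ[ℝ] R).toRingHom).eval t := by
  induction f using MvPolynomial.induction_on with
  | C a => simp [finSuccEquiv_apply]
  | add p q hp hq => simp only [map_add, hp, hq, Polynomial.map_add, Polynomial.eval_add]
  | mul_X p i hp =>
    rw [map_mul, map_mul, hp, Polynomial.map_mul, Polynomial.eval_mul, aeval_X]
    congr 1
    refine Fin.cases ?_ (fun j => ?_) i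
    · simp [finSuccEquiv_X_zero]
    · simp [finSuccEquiv_X_succ]

section Top

variable {m D : ℕ} {f : MvPolynomial (Fin (m + 1)) ℝ}

theorem MvPolynomial.IsHomogeneous.coeff_finSuccEquiv_eq_zero (hf : f.IsHomogeneous D) {k : ℕ}
    (hk : D < k) : (finSuccEquiv ℝ m f).coeff k = 0 := by
  ext d
  rw [finSuccEquiv_coeff_coeff, coeff_zero]
  refine hf.coeff_eq_zero fun h => ?_
  have : (Finsupp.cons k d).degree = k + d.degree := by
    simp [Finsupp.degree_eq_sum, Fin.sum_univ_succ]
  omega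

/-- In a form of degree `D` the coefficient of the `D`-th power of the first variable is constant,
namely the value of the form at the first basis vector. -/
theorem MvPolynomial.IsHomogeneous.coeff_finSuccEquiv_self (hf : f.IsHomogeneous D) :
    (finSuccEquiv ℝ m f).coeff D = C (eval (Fin.cons 1 0 : Fin (m + 1) → ℝ) f) := by
  have h0 : (finSuccEquiv ℝ m f).coeff D = C (((finSuccEquiv ℝ m f).coeff D).coeff 0) :=
    totalDegree_eq_zero_iff_eq_C.1
      ((totalDegree_zero_iff_isHomogeneous _).2 (hf.finSuccEquiv_coeff_isHomogeneous D 0 (add_zero D)))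
  rw [h0, eval_eq_eval_mv_eval']
  congr 1
  set c := ((finSuccEquiv ℝ m f).coeff D).coeff 0
  have hmap : (finSuccEquiv ℝ m f).map (eval (0 : Fin m → ℝ)) = Polynomial.monomial D c := by
    ext k
    rw [Polynomial.coeff_map, Polynomial.coeff_monomial, eval_zero, constantCoeff_eq]
    rcases lt_trichotomy k D with hk | rfl | hk
    · rw [if_neg hk.ne']
      refine (hf.finSuccEquiv_coeff_isHomogeneous k (D - k) (by omega)).coeff_eq_zero ?_
      simp only [map_zero]
      omega
    · rw [if_pos rfl]
    · rw [if_neg hk.ne, hf.coeff_finSuccEquiv_eq_zero hk, coeff_zero]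
  rw [hmap]
  simp

theorem IsStrictlyStable.eval_cons_one_zero_ne_zero (hs : IsStrictlyStable f) :
    eval (Fin.cons 1 0 : Fin (m + 1) → ℝ) f ≠ 0 := by
  intro h
  refine hs (fun i => ((Fin.cons 1 0 : Fin (m + 1) → ℝ) i : ℂ)) (fun i => ?_) ⟨0, by simp⟩ ?_
  · refine Fin.cases ?_ (fun j => ?_) i <;> simp
  · have := aeval_algebraMap_apply (A := ℝ) ℂ (Fin.cons 1 0 : Fin (m + 1) → ℝ) f
    rw [aeval_eq_eval_apply] at this
    rw [show (fun i => ((Fin.cons 1 0 : Fin (m + 1) → ℝ) i : ℂ)) =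
      algebraMap ℝ ℂ ∘ (Fin.cons 1 0 : Fin (m + 1) → ℝ) from rfl, this, h, map_zero]

/-- A strictly stable homogeneous polynomial has full degree in each variable. -/
theorem IsStrictlyStable.natDegree_map_finSuccEquiv (hs : IsStrictlyStable f)
    (hf : f.IsHomogeneous D) {R : Type*} [CommRing R] [Nontrivial R] [Algebra ℝ R]
    (z : Fin m → R) :
    ((finSuccEquiv ℝ m f).map
      (aeval z : MvPolynomial (Fin m) ℝ →ₐ[ℝ] R).toRingHom).natDegree = D := by
  refine le_antisymm (Polynomial.natDegree_le_iff_coeff_eq_zero.2 fun k hk => ?_)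
    (Polynomial.le_natDegree_of_ne_zero ?_)
  · rw [Polynomial.coeff_map, hf.coeff_finSuccEquiv_eq_zero hk, map_zero]
  · rw [Polynomial.coeff_map, hf.coeff_finSuccEquiv_self]
    simpa using hs.eval_cons_one_zero_ne_zero

end Top

variable {m : ℕ} {f : MvPolynomial (Fin (m + 1)) ℝ}

theorem cons_re_nonneg {t : ℂ} {z : Fin m → ℂ} (ht : 0 ≤ t.re) (hz : ∀ i, 0 ≤ (z i).re)
    (i : Fin (m + 1)) : 0 ≤ ((Fin.cons t z : Fin (m + 1) → ℂ) i).re :=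
  Fin.cases (by simpa using ht) (fun j => by simpa using hz j) i

/-- Strict stability passes to the linear coefficient in the first variable. -/
theorem IsStrictlyStable.coeff_one (hs : IsStrictlyStable f) (hf : f.IsHomogeneous (m + 1)) :
    IsStrictlyStable ((finSuccEquiv ℝ m f).coeff 1) := by
  rintro z hz ⟨i, hi⟩
  have h := Polynomial.coeff_one_ne_zero_of_roots_re_neg
    (g := (finSuccEquiv ℝ m f).map (aeval z : MvPolynomial (Fin m) ℝ →ₐ[ℝ] ℂ).toRingHom)
    (by rw [hs.natDegree_map_finSuccEquiv hf]; omega) fun t ht => by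
      rw [← aeval_cons]
      exact hs _ (cons_re_nonneg ht hz) ⟨i.succ, by simpa using hi⟩
  rwa [Polynomial.coeff_map] at h

/-- With the other variables real and positive, a strictly stable homogeneous polynomial has only
negative roots in the first variable: a root `t` off the real line could be rotated together with
the other variables into the closed right half-plane. -/
theorem IsStrictlyStable.root_neg (hs : IsStrictlyStable f) {D : ℕ} (hf : f.IsHomogeneous D)
    (hm : m ≠ 0) {x : Fin m → ℝ} (hx : ∀ i, 0 < x i) {t : ℂ}
    (ht : aeval (Fin.cons t fun i => (x i : ℂ) : Fin (m + 1) → ℂ) f = 0) :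
    t.im = 0 ∧ t.re < 0 := by
  have i0 : Fin m := ⟨0, Nat.pos_of_ne_zero hm⟩
  have hre : t.re < 0 := by
    by_contra! hc
    exact hs _ (cons_re_nonneg hc fun i => by simpa using (hx i).le)
      ⟨i0.succ, by simpa using hx i0⟩ ht
  refine ⟨?_, hre⟩
  by_contra him
  -- The rotation `w` makes `w * t` purely imaginary.
  set w : ℂ := ⟨1, t.re / t.im⟩ with hw
  have hwt : (w * t).re = 0 := by
    rw [Complex.mul_re]
    simp only [hw]
    field_simp
    ring
  have hwx : ∀ i, (w * (x i : ℂ)).re = x i := fun i => by simp [hw]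
  refine hs (fun i => w * (Fin.cons t fun i => (x i : ℂ) : Fin (m + 1) → ℂ) i) (fun i => ?_)
    ⟨i0.succ, ?_⟩ ?_
  · refine Fin.cases ?_ (fun j => ?_) i
    · rw [Fin.cons_zero, hwt]
    · rw [Fin.cons_succ, hwx]
      exact (hx j).le
  · rw [Fin.cons_succ, hwx]
    exact hx i0
  · rw [hf.aeval_smul, ht, mul_zero]

/-- One step of the capacity inequality: the loss from passing to the linear coefficient in the
first of `m + 1` variables is the factor `(m / (m + 1)) ^ m`. -/
theorem IsStrictlyStable.capacity_coeff_one (hs : IsStrictlyStable f)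
    (hf : f.IsHomogeneous (m + 1)) {C : ℝ} (hC0 : 0 ≤ C)
    (hC : ∀ x : Fin (m + 1) → ℝ, (∀ i, 0 < x i) → C * ∏ i, x i ≤ eval x f)
    (x : Fin m → ℝ) (hx : ∀ i, 0 < x i) :
    C * ((m : ℝ) / (m + 1)) ^ m * ∏ i, x i ≤ eval x ((finSuccEquiv ℝ m f).coeff 1) := by
  -- With a single variable there is nothing to restrict to: the polynomial is a multiple of it.
  rcases Nat.eq_zero_or_pos m with rfl | hm
  · have h1 := hC (Fin.cons 1 0) fun i => Fin.cases (by simp) (fun j => j.elim0) i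
    have h2 : (finSuccEquiv ℝ 0 f).coeff 1 = _ := hf.coeff_finSuccEquiv_self
    rw [h2, eval_C]
    simpa using h1
  · set g : Polynomial ℝ := (finSuccEquiv ℝ m f).map
      (aeval x : MvPolynomial (Fin m) ℝ →ₐ[ℝ] ℝ).toRingHom with hg
    have hgeval : ∀ t, g.eval t = eval (Fin.cons t x : Fin (m + 1) → ℝ) f := fun t => by
      rw [hg, ← aeval_cons, aeval_eq_eval_apply]
    have hgC : ∀ t, 0 < t → C * (∏ i, x i) * t ≤ g.eval t := fun t ht => by
      have := hC (Fin.cons t x) fun i =>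
        Fin.cases (by simpa using ht) (fun j => by simpa using hx j) i
      rw [Fin.prod_univ_succ, Fin.cons_zero] at this
      simp only [Fin.cons_succ] at this
      rw [hgeval]
      linarith
    have haeval : ∀ t : ℂ, Polynomial.aeval t g =
        aeval (Fin.cons t fun i => (x i : ℂ) : Fin (m + 1) → ℂ) f := fun t => by
      rw [aeval_cons, Polynomial.aeval_def, ← Polynomial.eval_map, hg, Polynomial.map_map]
      congr 2
      refine MvPolynomial.ringHom_ext (fun a => ?_) fun i => ?_ <;> simp
    have hroots : ∀ t : ℂ, Polynomial.aeval t g = 0 → t.im = 0 ∧ t.re < 0 := fun t ht =>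
      hs.root_neg hf hm.ne' hx (haeval t ▸ ht)
    have hg0 : 0 < g.eval 0 := by
      refine lt_of_le_of_ne ?_ fun h => ?_
      · have hlim : Filter.Tendsto (fun t => g.eval t) (nhdsWithin 0 (Set.Ioi 0))
            (nhds (g.eval 0)) := g.continuous.continuousWithinAt
        refine ge_of_tendsto hlim (Filter.mem_of_superset self_mem_nhdsWithin fun t ht => ?_)
        refine le_trans ?_ (hgC t ht)
        have := Finset.prod_nonneg fun i (_ : i ∈ Finset.univ) => (hx i).le
        have ht' : (0 : ℝ) < t := ht
        positivity
      · have h1 : Polynomial.aeval ((0 : ℝ) : ℂ) g = 0 := by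
          rw [show ((0 : ℝ) : ℂ) = algebraMap ℝ ℂ 0 from rfl,
            Polynomial.aeval_algebraMap_apply_eq_algebraMap_eval, ← h, map_zero]
        simpa using (hroots _ h1).2
    have h := Polynomial.le_coeff_one_of_roots_neg hm.ne'
      (hs.natDegree_map_finSuccEquiv hf x) hg0 hroots hgC
    rw [Polynomial.coeff_map] at h
    have h2 : (aeval x : MvPolynomial (Fin m) ℝ →ₐ[ℝ] ℝ).toRingHom
        ((finSuccEquiv ℝ m f).coeff 1) = eval x ((finSuccEquiv ℝ m f).coeff 1) := by
      change aeval x _ = _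
      rw [aeval_eq_eval_apply]
    rw [h2] at h
    linarith

/-- The exponent of the monomial `x₁ ⋯ xₘ`. -/
noncomputable def onesExponent (m : ℕ) : Fin m →₀ ℕ := Finsupp.equivFunOnFinite.symm fun _ => 1

theorem cons_onesExponent (m : ℕ) : (onesExponent m).cons 1 = onesExponent (m + 1) := by
  ext i
  refine Fin.cases ?_ (fun j => ?_) i <;> simp [onesExponent]

/-- The factors `(k / (k + 1)) ^ k` lost in the successive steps multiply to `m! / m ^ m`. -/
theorem IsStrictlyStable.capacity_le_coeff (m : ℕ) {f : MvPolynomial (Fin m) ℝ}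
    (hs : IsStrictlyStable f) (hf : f.IsHomogeneous m) {C : ℝ} (hC0 : 0 ≤ C)
    (hC : ∀ x : Fin m → ℝ, (∀ i, 0 < x i) → C * ∏ i, x i ≤ eval x f) :
    C * ((m ! : ℝ) / (m : ℝ) ^ m) ≤ f.coeff (onesExponent m) := by
  induction m generalizing C with
  | zero =>
    have h1 := hC 0 fun i => i.elim0
    have h2 : onesExponent 0 = 0 := Subsingleton.elim _ _
    rw [eval_zero, constantCoeff_eq] at h1
    simpa [h2] using h1
  | succ m ih =>
    have h := ih (hs.coeff_one hf) (hf.finSuccEquiv_coeff_isHomogeneous 1 m (add_comm 1 m))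
      (C := C * ((m : ℝ) / (m + 1)) ^ m) (by positivity) (hs.capacity_coeff_one hf hC0 hC)
    rw [finSuccEquiv_coeff_coeff, cons_onesExponent] at h
    refine le_of_eq_of_le ?_ h
    have hm : (m : ℝ) ^ m ≠ 0 := by
      rcases Nat.eq_zero_or_pos m with rfl | hm
      · simp
      · positivity
    have hm1 : ((m : ℝ) + 1) ≠ 0 := by positivity
    rw [Nat.factorial_succ, div_pow]
    push_cast
    rw [pow_succ]
    field_simp

/-- **Gurvits' inequality.** The stable case follows from the strictly stable one by substituting
`xᵢ + ε ∑ xⱼ` for `xᵢ` and letting `ε` tend to zero. -/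
theorem IsStable.capacity_le_coeff {m : ℕ} {f : MvPolynomial (Fin m) ℝ}
    (hs : IsStable f) (hf : f.IsHomogeneous m) {C : ℝ} (hC0 : 0 ≤ C)
    (hC : ∀ x : Fin m → ℝ, (∀ i, 0 < x i) → C * ∏ i, x i ≤ eval x f) :
    C * ((m ! : ℝ) / (m : ℝ) ^ m) ≤ f.coeff (onesExponent m) := by
  -- `Q` is the substitution with an indeterminate in place of `ε`: it shows that the coefficients
  -- of `g ε` are polynomials in `ε`, hence continuous.
  set Q : MvPolynomial (Fin m) (Polynomial ℝ) :=
    eval₂ (MvPolynomial.C.comp Polynomial.C)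
      (fun i => X i + MvPolynomial.C Polynomial.X * ∑ j, X j) f with hQ
  set g : ℝ → MvPolynomial (Fin m) ℝ := fun ε =>
    aeval (fun i => X i + MvPolynomial.C ε * ∑ j, X j) f with hg
  have hQg : ∀ ε, map (Polynomial.evalRingHom ε) Q = g ε := fun ε => by
    rw [hQ, hom_eval₂, hg]
    simp only [aeval_def]
    congr 1
    · ext
      simp
    · ext1 i
      simp
  have hcoeff : ∀ ε, (g ε).coeff (onesExponent m) = (Q.coeff (onesExponent m)).eval ε := fun ε => by
    rw [← hQg, coeff_map]
    rfl
  have hg0 : g 0 = f := by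
    simp [hg]
  have hpos : ∀ ε, 0 < ε → C * ((m ! : ℝ) / (m : ℝ) ^ m) ≤ (g ε).coeff (onesExponent m) := by
    intro ε hε
    have haev : ∀ {R : Type} [CommRing R] [Algebra ℝ R] (z : Fin m → R),
        aeval z (g ε) = aeval (fun i => z i + algebraMap ℝ R ε * ∑ j, z j) f := by
      intro R _ _ z
      rw [hg]
      simp only
      rw [← AlgHom.comp_apply, comp_aeval]
      congr 2
      ext1 i
      simp [map_sum]
    refine IsStrictlyStable.capacity_le_coeff m (fun z hz hz' => ?_) ?_ hC0 fun x hx => ?_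
    · rw [haev]
      refine hs _ fun i => ?_
      obtain ⟨j, hj⟩ := hz'
      have hsum : 0 < (∑ j, z j).re := by
        rw [Complex.re_sum]
        exact Finset.sum_pos' (fun k _ => hz k) ⟨j, Finset.mem_univ j, hj⟩
      have : ((algebraMap ℝ ℂ ε) * ∑ j, z j).re = ε * (∑ j, z j).re := by
        simp
      rw [Complex.add_re, this]
      exact add_pos_of_nonneg_of_pos (hz i) (mul_pos hε hsum)
    · have := hf.aeval (S := ℝ) (n := 1) (fun i => X i + MvPolynomial.C ε * ∑ j, X j) fun i =>
        (isHomogeneous_X _ i).add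
          ((IsHomogeneous.sum _ _ _ fun j _ => isHomogeneous_X _ j).C_mul ε)
      rwa [one_mul] at this
    · have h1 := haev x
      rw [aeval_eq_eval_apply, aeval_eq_eval_apply] at h1
      rw [h1]
      have hle : ∀ i, x i ≤ x i + algebraMap ℝ ℝ ε * ∑ j, x j := fun i =>
        le_add_of_nonneg_right (mul_nonneg hε.le (Finset.sum_nonneg fun j _ => (hx j).le))
      refine le_trans (mul_le_mul_of_nonneg_left ?_ hC0)
        (hC _ fun i => (hx i).trans_le (hle i))
      exact Finset.prod_le_prod (fun i _ => (hx i).le) fun i _ => hle i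
  have hlim : Filter.Tendsto (fun ε => (Q.coeff (onesExponent m)).eval ε)
      (nhdsWithin 0 (Set.Ioi 0)) (nhds ((Q.coeff (onesExponent m)).eval 0)) :=
    (Q.coeff (onesExponent m)).continuous.continuousWithinAt
  rw [← hcoeff, hg0] at hlim
  refine ge_of_tendsto hlim (Filter.mem_of_superset self_mem_nhdsWithin fun ε hε => ?_)
  have := hpos ε hε
  rwa [hcoeff] at this

end Stable

/-! ### The mixed derivative of a polynomial -/

section Derivative

open MvPolynomial

variable {n : ℕ}

theorem MvPolynomial.contDiff_eval (p : MvPolynomial (Fin n) ℝ) :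
    ContDiff ℝ ⊤ fun x : Fin n → ℝ => eval x p := by
  induction p using MvPolynomial.induction_on with
  | C a => simpa using contDiff_const
  | add p q hp hq => simpa using hp.add hq
  | mul_X p i hp => simpa using hp.mul (contDiff_apply ℝ ℝ i)

theorem MvPolynomial.hasFDerivAt_eval (p : MvPolynomial (Fin n) ℝ) (x : Fin n → ℝ) :
    HasFDerivAt (fun x : Fin n → ℝ => eval x p)
      (∑ i, eval x (pderiv i p) • (ContinuousLinearMap.proj i : (Fin n → ℝ) →L[ℝ] ℝ)) x := by
  induction p using MvPolynomial.induction_on with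
  | C a => simpa using hasFDerivAt_const a x
  | add p q hp hq =>
    simp only [map_add, add_smul, Finset.sum_add_distrib]
    exact hp.add hq
  | mul_X p i hp =>
    have h := hp.mul (hasFDerivAt_apply (𝕜 := ℝ) i x)
    simp only [map_mul, eval_X]
    refine h.congr_fderiv ?_
    ext v
    simp [pderiv_X, Pi.single_apply, Finset.sum_add_distrib, add_mul, apply_ite (eval x),
      Finset.mul_sum]
    ring_nf

theorem MvPolynomial.iteratedFDeriv_eval (p : MvPolynomial (Fin n) ℝ) (k : ℕ)
    (i : Fin k → Fin n) (x : Fin n → ℝ) :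
    iteratedFDeriv ℝ k (fun x : Fin n → ℝ => eval x p) x (fun j => Pi.single (i j) 1) =
      eval x ((List.ofFn i).foldr (fun j q => pderiv j q) p) := by
  induction k generalizing x with
  | zero => simp
  | succ k ih =>
    rw [iteratedFDeriv_succ_apply_left, List.ofFn_succ, List.foldr_cons]
    set q := (List.ofFn fun j : Fin k => i j.succ).foldr (fun j q => pderiv j q) p with hq
    have hd : DifferentiableAt ℝ (iteratedFDeriv ℝ k fun x : Fin n → ℝ => eval x p) x :=
      ((contDiff_eval p).differentiable_iteratedFDeriv (by
        exact_mod_cast WithTop.coe_lt_top _)) x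
    set v : Fin k → Fin n → ℝ := fun j => Pi.single (i j.succ) 1 with hv
    have h1 : HasFDerivAt (fun y => iteratedFDeriv ℝ k (fun x : Fin n → ℝ => eval x p) y v)
        ((ContinuousMultilinearMap.apply ℝ (fun _ : Fin k => Fin n → ℝ) ℝ v).comp
          (fderiv ℝ (iteratedFDeriv ℝ k fun x : Fin n → ℝ => eval x p) x)) x :=
      (ContinuousMultilinearMap.apply ℝ (fun _ : Fin k => Fin n → ℝ) ℝ v).hasFDerivAt.comp x
        hd.hasFDerivAt
    have h2 : (fun y => iteratedFDeriv ℝ k (fun x : Fin n → ℝ => eval x p) y v) =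
        fun y => eval y q := by
      ext1 y
      exact ih (fun j => i j.succ) y
    rw [h2] at h1
    have h3 := congrArg (fun L => L (Pi.single (i 0) 1)) (h1.unique (hasFDerivAt_eval q x))
    simp only [ContinuousLinearMap.comp_apply, ContinuousMultilinearMap.apply_apply] at h3
    refine h3.trans ?_
    simp [Pi.single_apply]

theorem MvPolynomial.coeff_foldr_pderiv (p : MvPolynomial (Fin n) ℝ) (l : List (Fin n))
    (hl : l.Nodup) (d : Fin n →₀ ℕ) (hd : ∀ i ∈ l, d i = 0) :
    (l.foldr (fun j q => pderiv j q) p).coeff d =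
      p.coeff (d + (l.map fun i => Finsupp.single i 1).sum) := by
  induction l generalizing d with
  | nil => simp
  | cons i l ih =>
    rw [List.nodup_cons] at hl
    rw [List.foldr_cons, coeff_pderiv, hd i List.mem_cons_self, ih hl.2]
    · simp [add_assoc]
    · intro j hj
      have hij : i ≠ j := fun h => hl.1 (h ▸ hj)
      simp [hd j (List.mem_cons_of_mem i hj), hij]

theorem MvPolynomial.IsHomogeneous.foldr_pderiv {p : MvPolynomial (Fin n) ℝ} {D : ℕ}
    (hp : p.IsHomogeneous D) (l : List (Fin n)) :
    (l.foldr (fun j q => pderiv j q) p).IsHomogeneous (D - l.length) := by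
  induction l with
  | nil => simpa using hp
  | cons i l ih =>
    rw [List.foldr_cons, List.length_cons, ← Nat.sub_sub]
    exact ih.pderiv

/-- For a form of degree `n` in `n` variables the mixed derivative is constant: it is the coefficient of
the monomial `x₁ ⋯ xₙ`. -/
theorem mixedDerivative_eval {p : MvPolynomial (Fin n) ℝ} (hp : p.IsHomogeneous n)
    (x : Fin n → ℝ) :
    mixedDerivative (fun x => eval x p) x = p.coeff (onesExponent n) := by
  refine (iteratedFDeriv_eval p n id x).trans ?_
  have h := hp.foldr_pderiv (List.ofFn id)
  rw [List.length_ofFn, Nat.sub_self] at h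
  rw [totalDegree_eq_zero_iff_eq_C.1 ((totalDegree_zero_iff_isHomogeneous _).2 h), eval_C,
    coeff_foldr_pderiv _ _ (List.nodup_ofFn.2 Function.injective_id) 0 fun _ _ => rfl, zero_add]
  congr 1
  rw [List.map_ofFn, List.sum_ofFn]
  ext j
  simp [onesExponent, Finsupp.finsetSum_apply, Finsupp.single_apply]

end Derivative

/-! ### The mixed discriminant of a doubly stochastic tuple -/

theorem mainTheorem4 (n : ℕ) (H : Fin n → Matrix (Fin n) (Fin n) ℍ[ℝ])
    (hH : IsDoublyStochasticTuple H) :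
    (∀ x : Fin n → ℝ, mooreDet (∑ i, x i • H i) = ((mooreForm H x : ℝ) : ℍ[ℝ])) ∧
      ∀ x : Fin n → ℝ, (n ! : ℝ) / (n : ℝ) ^ n ≤ mixedDerivative (mooreForm H) x := by
  obtain ⟨p, hp, hmoore, hpos, hp4⟩ := exists_polynomial_mooreDet hH
  have hform : mooreForm H = fun x => MvPolynomial.eval x p := by
    ext1 x
    rw [mooreForm, hmoore, Quaternion.re_coe]
  refine ⟨fun x => by rw [hmoore, hform], fun x => ?_⟩
  have hpsd : ∀ i, (realRep (H i)).PosSemidef := fun i => (hH.psd i).posSemidef_realRep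
  have hone : ∑ i, realRep (H i) = 1 := by rw [← map_sum, hH.sum_eq_one, map_one]
  have htrace : ∀ i, (realRep (H i)).trace = (4 : ℕ) := fun i => by
    rw [trace_realRep, hH.trace_eq_one i]
    simp
  have hstable : IsStable p := fun z hz h => by
    refine det_sum_smul_ne_zero hpsd hone hz ?_
    rw [← aeval_pencilDet, ← hp4, map_pow, h, zero_pow four_ne_zero]
  have hcap : ∀ x : Fin n → ℝ, (∀ i, 0 < x i) → 1 * ∏ i, x i ≤ MvPolynomial.eval x p := by
    intro x hx
    rw [one_mul]
    refine le_of_pow_le_pow_left₀ four_ne_zero (hpos x hx).le ?_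
    rw [← map_pow, hp4, ← MvPolynomial.aeval_eq_eval_apply, aeval_pencilDet]
    exact prod_pow_le_det_sum_smul hpsd hone htrace hx
  rw [hform, mixedDerivative_eval hp]
  simpa using hstable.capacity_le_coeff hp zero_le_one hcap
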